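/- Let $d\ge 1$, $m\ge 0$, $T>0$, let $A\subset\mathbb R^m$ be compact, and let $c:[0,T]\times\mathbb R^d\times A\to\mathbb R$, $f:[0,T]\times\mathbb R^d\times A\to\mathbb R^d$, $q:\mathbb R^d\to\mathbb R$. Assume, for a constant $K\ge 0$: (A1) $c$, $f$, $q$ are bounded by $K$ and Lipschitz continuous in all their variables with constant $K$; (A2) for all $(t,x,p)\in[0,T]\times\mathbb R^d\times\mathbb R^d$ the function $a\mapsto c(t,x,a)+p\cdot f(t,x,a)$ has a unique minimizer $\alpha(t,x,p)$ in $A$, and $\alpha$ is Lipschitz continuous in $(t,x,p)$ with constant $K$. Put $H(t,x,p)=\min_{a\in A}[c(t,x,a)+p\cdot f(t,x,a)]$ and let $N\ge\max\{1,\|f\|_\infty/2\}$. Let $v$ be the bounded continuous viscosity solution of $$\partial_t v+H(t,x,\nabla v)=0\ \text{ in }(0,T)\times\mathbb R^d,\qquad v(T,\cdot)=q,$$ and, for $h\in(0,1)$, let $v^h$ be the bounded continuous solution of the semi-discrete scheme $$\partial_t v^h+H(t,x,\nabla^h v^h)=-Nh\,\Delta^h v^h\ \text{ in }(0,T)\times\mathbb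 R^d,\qquad v^h(T,\cdot)=q,$$ where, with $e_1,\dots,e_d$ the standard basis, $$\nabla^h\varphi(x)=\Big(\tfrac{\varphi(x+he_i)-\varphi(x-he_i)}{2h}\Big)_{i=1}^d,\qquad \Delta^h\varphi(x)=\sum_{i=1}^d\tfrac{\varphi(x+he_i)-2\varphi(x)+\varphi(x-he_i)}{h^2}.$$ Then $v$ is Lipschitz continuous in $x$, uniformly in $t\in[0,T]$, so that the norm $\|\nabla v\|_\infty$ of its spatial gradient in $L^\infty([0,T]\times\mathbb R^d)$ is finite, and there is a constant $C>0$ depending only on $d$, $N$ and $K$ (in particular not on $T$, $h$, $m$) such that $$\sup_{[0,T]\times\mathbb R^d}|v-v^h|\le C(1+T)\,(1+\|\nabla v\|_\infty)\sqrt h \qquad\text{and}\qquad \sup_{[0,T]\times\mathbb R^d}|v-v^h|\le C e^{CT}\sqrt h .$$ The rate $\sqrt h$ is sharp: for all $d\ge1$, $N\ge 1$ and $T>0$ there are data $m,A,c,f,q$ satisfying these hypotheses for some $K$, with solutions $v$ and $v^h$ ($h\in(0,1)$) as above, and a constant $\kappa>0$ such that $\sup_{[0,T]\times\mathbb R^d}|v-v^h|\ge\kappa\sqrt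 h$ for all $h\in(0,1)$. -/

import Mathlib

open scoped NNReal ENNReal
open Set MeasureTheory

noncomputable section

namespace HJB

/-- `E d` is `ℝ^d` with its Euclidean norm. -/
abbrev E (d : ℕ) : Type := EuclideanSpace ℝ (Fin d)

/-- The data of a deterministic control problem with state space `ℝ^d`: the control set
`A ⊆ ℝ^m`, the running cost `c(t,x,a)`, the drift `f(t,x,a)` and the terminal cost `q(x)`.
Only times `t ∈ [0,T]` and controls `a ∈ A` matter below. -/
structure ControlProblem (d m : ℕ) where
  A : Set (E m)
  c : ℝ → E d → E m → ℝ
  f : ℝ → E d → E m → E d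
  q : E d → ℝ

variable {d m : ℕ}

/-- The quantity `c(t,x,a) + p · f(t,x,a)` to be minimized over `a ∈ A`. -/
def ControlProblem.preHamiltonian (P : ControlProblem d m) (t : ℝ) (x p : E d) (a : E m) : ℝ :=
  P.c t x a + inner ℝ p (P.f t x a)

/-- The Hamiltonian `H(t,x,p) = inf_{a ∈ A} [c(t,x,a) + p · f(t,x,a)]`. -/
def ControlProblem.H (P : ControlProblem d m) (t : ℝ) (x p : E d) : ℝ :=
  sInf (P.preHamiltonian t x p '' P.A)

/-- Assumption (A1) with constant `K`, on the time interval `[0,T]`: `c`, `f`, `q` are bounded by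
`K` and are `K`-Lipschitz jointly in all their variables. -/
structure AssumptionA1 (P : ControlProblem d m) (T : ℝ) (K : ℝ≥0) : Prop where
  c_bound : ∀ t ∈ Icc 0 T, ∀ x, ∀ a ∈ P.A, |P.c t x a| ≤ K
  f_bound : ∀ t ∈ Icc 0 T, ∀ x, ∀ a ∈ P.A, ‖P.f t x a‖ ≤ K
  q_bound : ∀ x, |P.q x| ≤ K
  c_lip : LipschitzOnWith K (fun z : ℝ × E d × E m => P.c z.1 z.2.1 z.2.2)
    (Icc 0 T ×ˢ univ ×ˢ P.A)
  f_lip : LipschitzOnWith K (fun z : ℝ × E d × E m => P.f z.1 z.2.1 z.2.2)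
    (Icc 0 T ×ˢ univ ×ˢ P.A)
  q_lip : LipschitzWith K P.q

/-- `α` is the unique minimizer selection:
for all `t ∈ [0,T]`, `α(t,x,p)` is the only minimizer in `A` of `c(t,x,a) + p · f(t,x,a)`. -/
def IsUniqueArgmin (P : ControlProblem d m) (T : ℝ) (α : ℝ → E d → E d → E m) : Prop :=
  ∀ t ∈ Icc 0 T, ∀ x p, α t x p ∈ P.A ∧
    (∀ a ∈ P.A, P.preHamiltonian t x p (α t x p) ≤ P.preHamiltonian t x p a) ∧
    (∀ b ∈ P.A, (∀ a ∈ P.A, P.preHamiltonian t x p b ≤ P.preHamiltonian t x p a) → b = α t x p)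

/-- Assumption (A2) with constant `K`: the argmin `α(t,x,p)` is unique and is `K`-Lipschitz
jointly in `(t,x,p) ∈ [0,T] × ℝ^d × ℝ^d`. -/
def AssumptionA2 (P : ControlProblem d m) (T : ℝ) (K : ℝ≥0) : Prop :=
  ∃ α : ℝ → E d → E d → E m, IsUniqueArgmin P T α ∧
    LipschitzOnWith K (fun z : ℝ × E d × E d => α z.1 z.2.1 z.2.2) (Icc 0 T ×ˢ univ)

/-- The standing hypotheses: `A` is compact, (A1) and (A2) hold with constant `K`, and
`N ≥ max {1, ‖f‖_∞ / 2}`. -/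
structure Standing (P : ControlProblem d m) (T : ℝ) (K : ℝ≥0) (N : ℝ) : Prop where
  compact : IsCompact P.A
  a1 : AssumptionA1 P T K
  a2 : AssumptionA2 P T K
  one_le : 1 ≤ N
  f_le : ∀ t ∈ Icc 0 T, ∀ x, ∀ a ∈ P.A, ‖P.f t x a‖ / 2 ≤ N

/-- `u` is bounded and continuous on `[0,T] × ℝ^d`. -/
def IsBddCont (T : ℝ) (u : ℝ → E d → ℝ) : Prop :=
  ContinuousOn (fun z : ℝ × E d => u z.1 z.2) (Icc 0 T ×ˢ univ) ∧
    ∃ B : ℝ, ∀ t ∈ Icc 0 T, ∀ x, |u t x| ≤ B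

/-- `v` is a bounded continuous viscosity solution of the terminal value problem
`∂_t v + H(t,x,∇v) = 0` in `(0,T) × ℝ^d`, `v(T,·) = q`. Because the problem is posed backward in
time, the subsolution inequality is `∂_t φ + H ≥ 0` wherever `v - φ` has a local maximum, and the
supersolution inequality is `∂_t φ + H ≤ 0` wherever `v - φ` has a local minimum. -/
structure IsViscositySolution (P : ControlProblem d m) (T : ℝ) (v : ℝ → E d → ℝ) : Prop where
  bddCont : IsBddCont T v
  sub : ∀ φ : ℝ × E d → ℝ, ContDiff ℝ 1 φ → ∀ t ∈ Ioo 0 T, ∀ x,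
    IsLocalMax (fun z : ℝ × E d => v z.1 z.2 - φ z) (t, x) →
    0 ≤ deriv (fun s => φ (s, x)) t + P.H t x (gradient (fun y => φ (t, y)) x)
  super : ∀ φ : ℝ × E d → ℝ, ContDiff ℝ 1 φ → ∀ t ∈ Ioo 0 T, ∀ x,
    IsLocalMin (fun z : ℝ × E d => v z.1 z.2 - φ z) (t, x) →
    deriv (fun s => φ (s, x)) t + P.H t x (gradient (fun y => φ (t, y)) x) ≤ 0
  terminal : ∀ x, v T x = P.q x

/-- The central difference gradient `∇^h φ(x)`, with `i`-th coordinate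
`(φ(x + h e_i) - φ(x - h e_i)) / (2h)`. -/
def discGrad (h : ℝ) (φ : E d → ℝ) (x : E d) : E d :=
  WithLp.toLp 2 fun i =>
    (φ (x + h • EuclideanSpace.single i (1 : ℝ)) - φ (x - h • EuclideanSpace.single i (1 : ℝ)))
      / (2 * h)

/-- The discrete Laplacian
`Δ^h φ(x) = ∑ i, (φ(x + h e_i) - 2 φ(x) + φ(x - h e_i)) / h^2`. -/
def discLaplacian (h : ℝ) (φ : E d → ℝ) (x : E d) : ℝ :=
  ∑ i, (φ (x + h • EuclideanSpace.single i (1 : ℝ)) - 2 * φ x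
    + φ (x - h • EuclideanSpace.single i (1 : ℝ))) / h ^ 2

/-- `u` is a bounded continuous solution of the semi-discrete scheme
`∂_t u + H(t,x,∇^h u) = - N h Δ^h u` in `(0,T) × ℝ^d`, `u(T,·) = q`. For fixed `x` this is an
ordinary differential equation in `t` with continuous right-hand side, so `∂_t` is classical. -/
structure IsSchemeSolution (P : ControlProblem d m) (T N h : ℝ) (u : ℝ → E d → ℝ) : Prop where
  bddCont : IsBddCont T u
  eqn : ∀ t ∈ Ioo 0 T, ∀ x, ∃ u' : ℝ, HasDerivAt (fun s => u s x) u' t ∧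
    u' + P.H t x (discGrad h (u t) x) = - N * h * discLaplacian h (u t) x
  terminal : ∀ x, u T x = P.q x

/-- `‖∇v‖_∞`: the `L^∞([0,T] × ℝ^d)` norm (an essential supremum, in `[0,∞]`) of the spatial
gradient of `v`. -/
def gradSupNorm (T : ℝ) (v : ℝ → E d → ℝ) : ℝ≥0∞ :=
  eLpNorm (fun z : ℝ × E d => gradient (v z.1) z.2) ⊤ (volume.restrict (Icc 0 T ×ˢ univ))

end HJB

end

noncomputable section

namespace HJB

variable {d : ℕ}

/-! Everything except sharpness comes from one comparison argument by doubling of variables,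
`doubling`. If `u` exceeded `w` by too much, then `u t x - w s y`, minus the penalty `θ t * softNorm
δ (x - y)`, a term linear in time and localizing terms, would have a positive maximum at interior
times, where the sub- and supersolution inequalities contradict each other. Besides boundedness and
continuity, `w` only needs its terminal bound and `IsApproxSuper`: contact from below by the concave
functions `a(s) - ϑ softNorm δ (x₀ - y)`, with error `e ϑ`. Minima are global because the scheme is
nonlocal. A viscosity solution has `e = 0`; the scheme has `e ϑ = d N h ϑ / δ`, since it is monotone
(`|f i| ≤ 2 N`) and `softNorm δ` has second derivatives at most `1 / δ`. No Lipschitz bound for `vh`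
is needed.

Taking `w = v` and `θ` exponential in `T - t` gives the Lipschitz bound for `v`. Taking `w = vh` and
a constant `θ`, of the order of a Lipschitz constant of `v` plus `K + 1`, keeps `‖x - y‖ ≤ 2 δ` at
the maximum; the penalty and the `x`-dependence of `H` then cost order `δ`, the scheme costs order
`h / δ`, and `δ = √h` balances the two. The opposite inequality is the same result for `-v`, `-vh`
and the Hamiltonian `-H(t, x, -p)`. The first bound uses `‖∇v‖_∞` as the Lipschitz constant
(`sub_le_gradSupNorm`), the second the explicit exponential one.

For sharpness take `c = f = 0`. Then `v` is stationary, while the scheme is a discrete heat equation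
with diffusivity `N h`, which lifts the tip of the kink `|x_i|` by order `√h`. A cosine wave of
length of order `√h` below the kink, an eigenfunction of the discrete Laplacian, proves the lower
bound (`le_heatFlow_kink`). -/

/-- The smoothed norm `√(‖z‖² + δ²)`. -/
def softNorm (δ : ℝ) (z : E d) : ℝ := √(‖z‖ ^ 2 + δ ^ 2)

/-- The gradient of `softNorm δ` at `z`. -/
def softGrad (δ : ℝ) (z : E d) : E d := (softNorm δ z)⁻¹ • z

/-! ### Calculus of the smoothed norm -/

section SoftNorm

variable {δ : ℝ}

lemma softNorm_sq (δ : ℝ) (z : E d) : softNorm δ z ^ 2 = ‖z‖ ^ 2 + δ ^ 2 :=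
  Real.sq_sqrt (by positivity)

lemma softNorm_nonneg (δ : ℝ) (z : E d) : 0 ≤ softNorm δ z := Real.sqrt_nonneg _

lemma norm_le_softNorm (δ : ℝ) (z : E d) : ‖z‖ ≤ softNorm δ z :=
  Real.le_sqrt_of_sq_le (by nlinarith [sq_nonneg δ])

lemma le_softNorm (δ : ℝ) (z : E d) : δ ≤ softNorm δ z :=
  Real.le_sqrt_of_sq_le (by nlinarith [sq_nonneg ‖z‖])

lemma softNorm_pos (hδ : 0 < δ) (z : E d) : 0 < softNorm δ z := hδ.trans_le (le_softNorm δ z)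

lemma softNorm_le (hδ : 0 ≤ δ) (z : E d) : softNorm δ z ≤ ‖z‖ + δ :=
  Real.sqrt_le_iff.2 ⟨by positivity, by nlinarith [norm_nonneg z]⟩

lemma softNorm_zero (hδ : 0 ≤ δ) : softNorm δ (0 : E d) = δ := by
  simp [softNorm, Real.sqrt_sq hδ]

lemma softNorm_neg (δ : ℝ) (z : E d) : softNorm δ (-z) = softNorm δ z := by simp [softNorm]

lemma contDiff_softNorm (hδ : 0 < δ) : ContDiff ℝ 1 (softNorm δ : E d → ℝ) := by
  unfold softNorm
  exact ((contDiff_norm_sq ℝ).add contDiff_const).sqrt fun z => by positivity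

lemma continuous_softNorm (δ : ℝ) : Continuous (softNorm δ : E d → ℝ) := by
  unfold softNorm; fun_prop

lemma hasGradientAt_softNorm (hδ : 0 < δ) (z : E d) :
    HasGradientAt (softNorm δ) (softGrad δ z) z := by
  have h0 : ‖z‖ ^ 2 + δ ^ 2 ≠ 0 := by positivity
  have h := (((hasStrictFDerivAt_norm_sq z).hasFDerivAt).add_const (δ ^ 2)).sqrt h0
  rw [hasGradientAt_iff_hasFDerivAt]
  refine h.congr_fderiv ?_
  ext w
  have := (softNorm_pos hδ z).ne'
  simp only [softGrad, smul_apply, map_smul, innerSL_apply_apply,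
    InnerProductSpace.toDual_apply_apply, smul_eq_mul, nsmul_eq_mul]
  change 1 / (2 * softNorm δ z) * _ = _
  field_simp
  norm_num

lemma norm_softGrad_le (δ : ℝ) (z : E d) : ‖softGrad δ z‖ ≤ 1 := by
  rw [softGrad, norm_smul, norm_inv, Real.norm_of_nonneg (softNorm_nonneg δ z)]
  exact inv_mul_le_one_of_le₀ (norm_le_softNorm δ z) (softNorm_nonneg δ z)

/-- Quadratic upper bound: `softNorm δ` has second derivatives at most `1 / δ`. -/
lemma softNorm_add_le (hδ : 0 < δ) (z w : E d) :
    softNorm δ (z + w) ≤ softNorm δ z + inner ℝ (softGrad δ z) w + ‖w‖ ^ 2 / (2 * δ) := by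
  have hr := softNorm_pos hδ z
  have hle := le_softNorm δ z
  have h1 : softNorm δ (z + w) ^ 2 = softNorm δ z ^ 2 + 2 * inner ℝ z w + ‖w‖ ^ 2 := by
    rw [softNorm_sq, softNorm_sq, norm_add_sq_real]; ring
  have h2 : inner ℝ (softGrad δ z) w = inner ℝ z w / softNorm δ z := by
    rw [softGrad, real_inner_smul_left]; field_simp
  have h3 : ‖w‖ ^ 2 / (2 * softNorm δ z) ≤ ‖w‖ ^ 2 / (2 * δ) := by gcongr
  -- The square root lies below its tangent: `b ≤ (a² + b²) / (2 a)`.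
  have h4 : softNorm δ (z + w) ≤ (softNorm δ z ^ 2 + softNorm δ (z + w) ^ 2) / (2 * softNorm δ z) := by
    rw [le_div_iff₀ (by positivity)]
    nlinarith [sq_nonneg (softNorm δ z - softNorm δ (z + w))]
  calc _ ≤ _ := h4
    _ = softNorm δ z + inner ℝ z w / softNorm δ z + ‖w‖ ^ 2 / (2 * softNorm δ z) := by
      rw [h1]; field_simp; ring
    _ ≤ _ := by rw [h2]; gcongr

lemma softNorm_le_add (δ : ℝ) (x y : E d) : softNorm δ x ≤ softNorm δ y + ‖x - y‖ := by
  refine Real.sqrt_le_iff.2 ⟨add_nonneg (softNorm_nonneg _ _) (norm_nonneg _), ?_⟩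
  have h1 := softNorm_sq δ y
  have h2 : ‖x‖ ≤ ‖y‖ + ‖x - y‖ := by simpa using norm_add_le y (x - y)
  nlinarith [norm_le_softNorm δ y, norm_nonneg x, norm_nonneg y, norm_nonneg (x - y)]

end SoftNorm

/-! ### Structural conditions, one-sided solutions and tools for localization -/

/-- A Hamiltonian that is `K`-Lipschitz in `p` and `K (1 + ‖p‖)`-Lipschitz in `(t, x)`. -/
structure IsLipHam (H : ℝ → E d → E d → ℝ) (T K : ℝ) : Prop where
  lip_tx : ∀ t ∈ Icc 0 T, ∀ s ∈ Icc 0 T, ∀ x y p,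
    |H t x p - H s y p| ≤ K * (1 + ‖p‖) * (|t - s| + ‖x - y‖)
  lip_p : ∀ t ∈ Icc 0 T, ∀ x p p', |H t x p - H t x p'| ≤ K * ‖p - p'‖

/-- The subsolution property for `∂_t u + H(t, x, ∇u) = 0`, posed backward in time. -/
def IsViscositySub (H : ℝ → E d → E d → ℝ) (T : ℝ) (u : ℝ → E d → ℝ) : Prop :=
  ∀ φ : ℝ × E d → ℝ, ContDiff ℝ 1 φ → ∀ t ∈ Ioo 0 T, ∀ x,
    IsLocalMax (fun z : ℝ × E d => u z.1 z.2 - φ z) (t, x) →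
    0 ≤ deriv (fun s => φ (s, x)) t + H t x (gradient (fun y => φ (t, y)) x)

/-- The supersolution property up to an error `e ϑ`, for global minima and for the test functions
`a(s) - ϑ softNorm δ (x₀ - y)` only. -/
def IsApproxSuper (H : ℝ → E d → E d → ℝ) (T δ : ℝ) (e : ℝ → ℝ) (w : ℝ → E d → ℝ) : Prop :=
  ∀ a : ℝ → ℝ, ContDiff ℝ 1 a → ∀ ϑ : ℝ, 0 ≤ ϑ → ∀ x₀, ∀ s ∈ Ioo 0 T, ∀ y,
    (∀ s' ∈ Icc 0 T, ∀ y', w s y - a s + ϑ * softNorm δ (x₀ - y) ≤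
      w s' y' - a s' + ϑ * softNorm δ (x₀ - y')) →
    deriv a s + H s y (ϑ • softGrad δ (x₀ - y)) ≤ e ϑ

lemma exists_isMaxOn_of_compact {X : Type*} [TopologicalSpace X] {S C : Set X} {F : X → ℝ}
    (hF : ContinuousOn F S) (hS : IsClosed S) (hC : IsCompact C) {x₀ : X} (h₀ : x₀ ∈ S)
    (h : ∀ z ∈ S, z ∉ C → F z ≤ F x₀) : ∃ z ∈ S, ∀ z' ∈ S, F z' ≤ F z := by
  refine hF.exists_isMaxOn' hS h₀ ?_
  rw [Filter.eventually_inf_principal]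
  filter_upwards [hC.compl_mem_cocompact] with z hz hzS using h z hzS hz

/-- A steep exponential in time, large at `0` and small at `t₁`. -/
lemma exists_time_barrier {t₁ B σ : ℝ} (ht : 0 < t₁) (hσ : 0 < σ) :
    ∃ ψ : ℝ → ℝ, ContDiff ℝ 1 ψ ∧ (∀ t, 0 < ψ t) ∧ (∀ t, deriv ψ t ≤ 0) ∧ B < ψ 0 ∧ ψ t₁ ≤ σ := by
  -- The barrier is `X ^ (1 - 2 t / t₁)`, which falls from `X` at `0` to `1 / X` at `t₁`; so `X`
  -- must exceed `B` and be at least `1 / σ`.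
  set X : ℝ := max (B + 1) (max 1 (1 / σ)) with hX
  have hX1 : 1 ≤ X := (le_max_left _ _).trans (le_max_right _ _)
  have hX0 : 0 < X := by linarith
  have hl : 0 ≤ Real.log X := Real.log_nonneg hX1
  have hd : ∀ t, HasDerivAt (fun t => Real.exp ((1 - 2 * t / t₁) * Real.log X))
      (Real.exp ((1 - 2 * t / t₁) * Real.log X) * (-(2 / t₁) * Real.log X)) t := by
    intro t
    have := ((((hasDerivAt_id t).const_mul 2).div_const t₁).const_sub 1).mul_const (Real.log X)
    simpa using this.exp
  refine ⟨fun t => Real.exp ((1 - 2 * t / t₁) * Real.log X), ?_, fun t => Real.exp_pos _,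
    fun t => ?_, ?_, ?_⟩
  · fun_prop
  · rw [(hd t).deriv]
    have : 0 ≤ 2 / t₁ * Real.log X := by positivity
    nlinarith [Real.exp_pos ((1 - 2 * t / t₁) * Real.log X)]
  · have : B + 1 ≤ X := le_max_left _ _
    simp only [mul_zero, zero_div, sub_zero, one_mul, Real.exp_log hX0]
    linarith
  · have h1 : 1 / σ ≤ X := (le_max_right _ _).trans (le_max_right _ _)
    have : (1 - 2 * t₁ / t₁) * Real.log X = -Real.log X := by field_simp; ring
    simp only [this, Real.exp_neg, Real.exp_log hX0]
    rw [div_le_iff₀ hσ] at h1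
    rw [inv_le_iff_one_le_mul₀ hX0]
    linarith

lemma hasGradientAt_comp_sub {g : E d → ℝ} {g' x y : E d} (h : HasGradientAt g g' (x - y)) :
    HasGradientAt (fun z => g (z - y)) g' x := by
  rw [hasGradientAt_iff_hasFDerivAt] at h ⊢
  simpa [Function.comp_def] using h.comp x ((hasFDerivAt_id x).sub_const y)

end HJB

namespace HJB

variable {d : ℕ}

/-- Compactness gives uniformity on balls only, so in the doubling argument the radius has to be
fixed before the penalty on `t - s`. -/
lemma IsBddCont.uniform_time_modulus {T : ℝ} {u : ℝ → E d → ℝ} (hu : IsBddCont T u) (R : ℝ)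
    {σ : ℝ} (hσ : 0 < σ) :
    ∃ η > 0, ∀ t ∈ Icc 0 T, ∀ s ∈ Icc 0 T, |t - s| < η → ∀ x : E d, ‖x‖ ≤ R →
      |u t x - u s x| < σ := by
  have hK : IsCompact (Icc 0 T ×ˢ Metric.closedBall (0 : E d) R) :=
    isCompact_Icc.prod (isCompact_closedBall _ _)
  have := hK.uniformContinuousOn_of_continuous
    (hu.1.mono (prod_mono_right (subset_univ _)))
  obtain ⟨η, hη, h⟩ := Metric.uniformContinuousOn_iff.1 this σ hσ
  refine ⟨η, hη, fun t ht s hs hts x hx => ?_⟩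
  have hx' : x ∈ Metric.closedBall (0 : E d) R := by simpa using hx
  have := h (t, x) ⟨ht, hx'⟩ (s, x) ⟨hs, hx'⟩ 
    (by simpa [Prod.dist_eq, Real.dist_eq, hη] using hts)
  simpa [Real.dist_eq] using this

/-! ### Comparison by doubling of variables -/

section Doubling

variable {H : ℝ → E d → E d → ℝ} {T K δ lam lam₀ β G : ℝ} {e θ ψ : ℝ → ℝ} {u w : ℝ → E d → ℝ}

/-- The inequality that the equation gives at an interior maximum of the doubled functional. -/
lemma doubling_interior (hK : 0 ≤ K) (hδ : 0 < δ) (hH : IsLipHam H T K)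
    (hsub : IsViscositySub H T u) (hsup : IsApproxSuper H T δ e w)
    (hθ : ContDiff ℝ 1 θ) (hψ : ContDiff ℝ 1 ψ) (hψ' : ∀ t, deriv ψ t ≤ 0)
    (hβ : 0 ≤ β) {t s : ℝ} (ht : t ∈ Ioo 0 T) (hs : s ∈ Ioo 0 T) (hθt : 0 ≤ θ t) {x y : E d}
    (hmax : ∀ t' ∈ Icc 0 T, ∀ s' ∈ Icc 0 T, ∀ x' y',
      u t' x' - w s' y' - θ t' * softNorm δ (x' - y') - lam * (T - t') - β * softNorm 1 x'
        - ψ t' - ψ s' - G * (t' - s') ^ 2 ≤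
      u t x - w s y - θ t * softNorm δ (x - y) - lam * (T - t) - β * softNorm 1 x
        - ψ t - ψ s - G * (t - s) ^ 2) :
    lam ≤ K * (1 + θ t) * (|t - s| + ‖x - y‖) + K * β + deriv θ t * softNorm δ (x - y)
      + e (θ t) := by
  have htI := Ioo_subset_Icc_self ht
  have hsI := Ioo_subset_Icc_self hs
  have dθ := (hθ.differentiable one_ne_zero) t
  have dψ := hψ.differentiable one_ne_zero
  -- the subsolution inequality
  have h1 := hsub (fun z => θ z.1 * softNorm δ (z.2 - y) + lam * (T - z.1) + β * softNorm 1 z.2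
      + ψ z.1 + G * (z.1 - s) ^ 2) (by
        have a1 : ContDiff ℝ 1 fun z : ℝ × E d => softNorm δ (z.2 - y) :=
          (contDiff_softNorm hδ).comp (contDiff_snd.sub contDiff_const)
        have a2 : ContDiff ℝ 1 fun z : ℝ × E d => softNorm 1 z.2 :=
          (contDiff_softNorm one_pos).comp contDiff_snd
        have a3 : ContDiff ℝ 1 fun z : ℝ × E d => θ z.1 := hθ.comp contDiff_fst
        have a4 : ContDiff ℝ 1 fun z : ℝ × E d => ψ z.1 := hψ.comp contDiff_fst
        fun_prop) t ht x (by
        have : ∀ᶠ z : ℝ × E d in nhds (t, x), z.1 ∈ Icc 0 T :=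
          continuous_fst.continuousAt.eventually (Icc_mem_nhds ht.1 ht.2)
        filter_upwards [this] with z hz
        have := hmax z.1 hz s hsI z.2 y
        linarith)
  have hder : HasDerivAt (fun τ => θ τ * softNorm δ (x - y) + lam * (T - τ) + β * softNorm 1 x
      + ψ τ + G * (τ - s) ^ 2)
      (deriv θ t * softNorm δ (x - y) - lam + deriv ψ t + 2 * G * (t - s)) t := by
    have := ((((dθ.hasDerivAt.mul_const (softNorm δ (x - y))).add
      (((hasDerivAt_id t).const_sub T).const_mul lam)).add_const (β * softNorm 1 x)).add
      (dψ t).hasDerivAt).add ((((hasDerivAt_id t).sub_const s).pow 2).const_mul G)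
    refine HasDerivAt.congr_deriv this ?_
    simp; ring
  have hgrad : HasGradientAt (fun z => θ t * softNorm δ (z - y) + lam * (T - t) + β * softNorm 1 z
      + ψ t + G * (t - s) ^ 2) (θ t • softGrad δ (x - y) + β • softGrad 1 x) x := by
    have b1 := hasGradientAt_comp_sub (hasGradientAt_softNorm hδ (x - y))
    have b2 := hasGradientAt_softNorm one_pos x
    rw [hasGradientAt_iff_hasFDerivAt] at b1 b2 ⊢
    have := ((((b1.const_mul (θ t)).add_const (lam * (T - t))).add (b2.const_mul β)).add_const
      (ψ t)).add_const (G * (t - s) ^ 2)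
    simpa using this
  rw [hder.deriv, hgrad.gradient] at h1
  -- the supersolution inequality
  have hda : ∀ τ, HasDerivAt (fun τ => -(ψ τ) - G * (t - τ) ^ 2)
      (-(deriv ψ τ) + 2 * G * (t - τ)) τ := by
    intro τ
    have := (dψ τ).hasDerivAt.neg.sub ((((hasDerivAt_id τ).const_sub t).pow 2).const_mul G)
    refine HasDerivAt.congr_deriv this ?_
    simp; ring
  have h2 := hsup (fun τ => -(ψ τ) - G * (t - τ) ^ 2) (by fun_prop) (θ t) hθt x s hs y (by
    intro s' hs' y'
    have := hmax t htI s' hs' x y'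
    linarith)
  rw [(hda s).deriv] at h2
  set p := θ t • softGrad δ (x - y) with hp
  have hpn : ‖p‖ ≤ θ t := by
    rw [hp, norm_smul, Real.norm_of_nonneg hθt]
    exact mul_le_of_le_one_right hθt (norm_softGrad_le _ _)
  have h3 := (abs_le.1 (hH.lip_tx t htI s hsI x y p)).2
  have h4 := (abs_le.1 (hH.lip_p t htI x (p + β • softGrad 1 x) p)).2
  have h5 : ‖p + β • softGrad 1 x - p‖ ≤ β := by
    rw [add_sub_cancel_left, norm_smul, Real.norm_of_nonneg hβ]
    exact mul_le_of_le_one_right hβ (norm_softGrad_le _ _)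
  have h6 : K * ‖p + β • softGrad 1 x - p‖ ≤ K * β := by gcongr
  have h7 : K * (1 + ‖p‖) * (|t - s| + ‖x - y‖) ≤ K * (1 + θ t) * (|t - s| + ‖x - y‖) := by gcongr
  -- On subtracting the two inequalities the derivatives of `G (t - s)²` cancel, and both `deriv ψ`
  -- terms have the favourable sign.
  linarith [hψ' t, hψ' s]

/-- The premise inside `hint` is what maximality yields against the competitor with `x` replaced by
`y`; callers use it to bound `‖x - y‖`. Initial time is excluded because the barrier `ψ` needs `t₁ >
0`. -/
theorem doubling_Ioo (hT : 0 < T) (hK : 0 ≤ K) (hδ : 0 < δ) (hH : IsLipHam H T K)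
    (hu : IsBddCont T u) (hw : IsBddCont T w)
    (hsub : IsViscositySub H T u) (hsup : IsApproxSuper H T δ e w)
    (hθ : ContDiff ℝ 1 θ) (hθa : Antitone θ) (hθ1 : ∀ t ∈ Icc 0 T, 1 ≤ θ t) (hl : 0 ≤ lam₀)
    (hint : ∀ t ∈ Ioo 0 T, ∀ x y,
      θ t * (softNorm δ (x - y) - δ) - 1 / 2 * ‖x - y‖ ≤ u t x - u t y →
      K * (1 + θ t) * ‖x - y‖ + deriv θ t * softNorm δ (x - y) + e (θ t) ≤ lam₀)
    (hterm : ∀ x y, u T x - w T y ≤ θ T * softNorm δ (x - y)) :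
    ∀ t ∈ Ioo 0 T, ∀ x y, u t x - w t y ≤ θ t * softNorm δ (x - y) + lam₀ * (T - t) := by
  intro t₁ ht₁ x₁ y₁
  by_contra! hcon
  -- Of the gap `6 σ`, one `σ` pays for raising `lam₀` to `lam`, one for the `β` term and two for
  -- `ψ`; the functional is still at least `2 σ` at the bad point.
  obtain ⟨σ, hσ, hcon⟩ : ∃ σ > 0, θ t₁ * softNorm δ (x₁ - y₁) + lam₀ * (T - t₁) + 6 * σ ≤
      u t₁ x₁ - w t₁ y₁ :=
    ⟨(u t₁ x₁ - w t₁ y₁ - (θ t₁ * softNorm δ (x₁ - y₁) + lam₀ * (T - t₁))) / 6, by linarith,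
      by linarith⟩
  obtain ⟨Bu, hBu⟩ := hu.2
  obtain ⟨Bw, hBw⟩ := hw.2
  set B := Bu + Bw with hB
  have huw : ∀ t ∈ Icc 0 T, ∀ s ∈ Icc 0 T, ∀ x y, u t x - w s y ≤ B := fun t ht s hs x y => by
    linarith [(abs_le.1 (hBu t ht x)).2, (abs_le.1 (hBw s hs y)).1]
  have ht₁I := Ioo_subset_Icc_self ht₁
  obtain ⟨ψ, hψ, hψ0, hψ', hψB, hψσ⟩ := exists_time_barrier (B := B) ht₁.1 hσ
  set lam := lam₀ + σ / T with hlam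
  -- the localization parameter
  obtain ⟨β, hβ, hβ2, hβK, hβσ⟩ : ∃ β > 0, β ≤ 1 / 2 ∧ K * β ≤ σ / T / 3 ∧
      β * softNorm 1 x₁ ≤ σ := by
    refine ⟨min (1 / 2) (min (σ / T / 3 / (K + 1)) (σ / softNorm 1 x₁)), ?_, min_le_left _ _, ?_, ?_⟩
    · have := softNorm_pos one_pos x₁
      positivity
    · have h1 : min (1 / 2) (min (σ / T / 3 / (K + 1)) (σ / softNorm 1 x₁)) ≤ σ / T / 3 / (K + 1) :=
        (min_le_right _ _).trans (min_le_left _ _)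
      calc _ ≤ K * (σ / T / 3 / (K + 1)) := by gcongr
        _ ≤ (K + 1) * (σ / T / 3 / (K + 1)) := by gcongr; linarith
        _ = _ := by field_simp
    · have h1 : min (1 / 2) (min (σ / T / 3 / (K + 1)) (σ / softNorm 1 x₁)) ≤ σ / softNorm 1 x₁ :=
        (min_le_right _ _).trans (min_le_right _ _)
      rwa [le_div_iff₀ (softNorm_pos one_pos x₁)] at h1
  -- all relevant points lie in the ball of radius `R`
  set R := B / β + B with hR
  obtain ⟨η₁, hη₁, hmu⟩ := hu.uniform_time_modulus R hσ
  obtain ⟨η₂, hη₂, hmw⟩ := hw.uniform_time_modulus R hσ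
  have hθ0 : 1 ≤ θ 0 := hθ1 0 ⟨le_rfl, hT.le⟩
  set η := min (min η₁ η₂) (σ / T / 3 / (K * (1 + θ 0) + 1)) with hη
  have hη0 : 0 < η := by positivity
  have hηK : K * (1 + θ 0) * η ≤ σ / T / 3 := by
    have h1 : η ≤ σ / T / 3 / (K * (1 + θ 0) + 1) := min_le_right _ _
    rw [le_div_iff₀ (by positivity)] at h1
    linarith
  -- Large enough that a positive value of the functional forces `|t - s| < η`.
  set G := (|B| + 1) / η ^ 2 with hG
  have hG0 : 0 < G := by positivity
  have hGη : G * η ^ 2 = |B| + 1 := by rw [hG]; field_simp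
  let F : ℝ × ℝ × E d × E d → ℝ := fun z =>
    u z.1 z.2.2.1 - w z.2.1 z.2.2.2 - θ z.1 * softNorm δ (z.2.2.1 - z.2.2.2) - lam * (T - z.1)
      - β * softNorm 1 z.2.2.1 - ψ z.1 - ψ z.2.1 - G * (z.1 - z.2.1) ^ 2
  have hl0 : 0 ≤ lam := by positivity
  have hlam1 : lam * (T - t₁) ≤ lam₀ * (T - t₁) + σ := by
    have : σ / T * (T - t₁) ≤ σ / T * T := by gcongr; linarith [ht₁.1]
    rw [hlam, add_mul]
    have h2 : σ / T * T = σ := by field_simp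
    linarith
  have hF1 : 2 * σ ≤ F (t₁, t₁, x₁, y₁) := by
    simp only [F, sub_self]
    linarith
  -- consequences of `F z > 0`
  have hpos : ∀ t ∈ Icc 0 T, ∀ s ∈ Icc 0 T, ∀ x y, 0 < F (t, s, x, y) →
      t ∈ Ioc 0 T ∧ s ∈ Ioc 0 T ∧ ‖x‖ ≤ R ∧ ‖y‖ ≤ R ∧ |t - s| < η := by
    intro t ht s hs x y hF
    simp only [F] at hF
    have h1 := huw t ht s hs x y
    -- Since `θ ≥ 1`, the penalty also confines `y`, although the `β` term localizes only `x`.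
    have h2 : ‖x - y‖ ≤ θ t * softNorm δ (x - y) := by
      nlinarith [hθ1 t ht, norm_le_softNorm δ (x - y), softNorm_nonneg δ (x - y)]
    have h3 : β * ‖x‖ ≤ β * softNorm 1 x := by gcongr; exact norm_le_softNorm _ _
    have h4 : 0 ≤ lam * (T - t) := mul_nonneg hl0 (by linarith [ht.2])
    have h5 : 0 ≤ G * (t - s) ^ 2 := by positivity
    have h6 := hψ0 t
    have h7 := hψ0 s
    have h8 := norm_nonneg (x - y)
    have h9 : 0 ≤ β * ‖x‖ := by positivity
    have hx : ‖x‖ ≤ B / β := by rw [le_div_iff₀ hβ]; linarith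
    have hB0 : 0 ≤ B := by linarith
    refine ⟨⟨lt_of_le_of_ne ht.1 ?_, ht.2⟩, ⟨lt_of_le_of_ne hs.1 ?_, hs.2⟩, ?_, ?_, ?_⟩
    · rintro rfl; linarith
    · rintro rfl; linarith
    · linarith
    · have : ‖y‖ ≤ ‖x‖ + ‖x - y‖ := by
        have := norm_sub_le x (x - y); simpa using this
      linarith
    · refine abs_lt_of_sq_lt_sq ?_ hη0.le
      have : G * (t - s) ^ 2 < G * η ^ 2 := by rw [hGη]; linarith [le_abs_self B]
      exact lt_of_mul_lt_mul_left this hG0.le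
  obtain ⟨⟨t, s, x, y⟩, ⟨ht, hs, -⟩, hmax⟩ : ∃ z ∈ Icc 0 T ×ˢ Icc 0 T ×ˢ (univ : Set (E d × E d)),
      ∀ z' ∈ Icc 0 T ×ˢ Icc 0 T ×ˢ (univ : Set (E d × E d)), F z' ≤ F z := by
    refine exists_isMaxOn_of_compact (x₀ := (t₁, t₁, x₁, y₁))
      (C := Icc 0 T ×ˢ Icc 0 T ×ˢ Metric.closedBall 0 R ×ˢ Metric.closedBall 0 R) ?_
      (isClosed_Icc.prod (isClosed_Icc.prod isClosed_univ))
      (isCompact_Icc.prod (isCompact_Icc.prod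
        ((isCompact_closedBall _ _).prod (isCompact_closedBall _ _))))
      ⟨ht₁I, ht₁I, trivial⟩ ?_
    · have c1 : ContinuousOn (fun z : ℝ × ℝ × E d × E d => u z.1 z.2.2.1)
          (Icc 0 T ×ˢ Icc 0 T ×ˢ (univ : Set (E d × E d))) :=
        hu.1.comp (f := fun z : ℝ × ℝ × E d × E d => (z.1, z.2.2.1)) (by fun_prop)
          fun z hz => ⟨hz.1, trivial⟩
      have c2 : ContinuousOn (fun z : ℝ × ℝ × E d × E d => w z.2.1 z.2.2.2)
          (Icc 0 T ×ˢ Icc 0 T ×ˢ (univ : Set (E d × E d))) :=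
        hw.1.comp (f := fun z : ℝ × ℝ × E d × E d => (z.2.1, z.2.2.2)) (by fun_prop)
          fun z hz => ⟨hz.2.1, trivial⟩
      have c3 := hθ.continuous
      have c4 := hψ.continuous
      have c5 := continuous_softNorm (d := d) δ
      have c6 := continuous_softNorm (d := d) 1
      have c7 : Continuous fun z : ℝ × ℝ × E d × E d =>
        θ z.1 * softNorm δ (z.2.2.1 - z.2.2.2) + lam * (T - z.1)
          + β * softNorm 1 z.2.2.1 + ψ z.1 + ψ z.2.1 + G * (z.1 - z.2.1) ^ 2 := by fun_prop
      refine ((c1.sub c2).sub c7.continuousOn).congr fun z _ => ?_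
      simp only [F, Pi.sub_apply]; ring
    · rintro ⟨t, s, x, y⟩ ⟨ht, hs, -⟩ hz
      by_contra! hlt
      obtain ⟨-, -, hx, hy, -⟩ := hpos t ht s hs x y (by linarith)
      exact hz ⟨ht, hs, by simpa using hx, by simpa using hy⟩
  have hFz : 2 * σ ≤ F (t, s, x, y) := hF1.trans (hmax _ ⟨ht₁I, ht₁I, trivial⟩)
  obtain ⟨ht0, hs0, hxR, hyR, hts⟩ := hpos t ht s hs x y (by linarith)
  have hts₁ : |t - s| < η₁ := hts.trans_le ((min_le_left _ _).trans (min_le_left _ _))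
  have hts₂ : |t - s| < η₂ := hts.trans_le ((min_le_left _ _).trans (min_le_right _ _))
  have hFz' : θ t * softNorm δ (x - y) + 2 * σ ≤ u t x - w s y := by
    simp only [F] at hFz
    have h4 : 0 ≤ lam * (T - t) := mul_nonneg hl0 (by linarith [ht.2])
    have h5 : 0 ≤ G * (t - s) ^ 2 := by positivity
    have h6 := hψ0 t
    have h7 := hψ0 s
    have h8 : 0 ≤ β * softNorm 1 x := mul_nonneg hβ.le (softNorm_nonneg _ _)
    linarith
  have hTI : T ∈ Icc 0 T := ⟨hT.le, le_rfl⟩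
  -- If one time equals `T`, moving the other there costs less than `σ`, so the surplus `2 σ`
  -- contradicts the terminal inequality.
  rcases ht0.2.eq_or_lt with rfl | htT
  · have h1 := (abs_lt.1 (hmw t hTI s hs hts₂ y hyR)).2
    linarith [hterm x y]
  rcases hs0.2.eq_or_lt with rfl | hsT
  · have h1 := (abs_lt.1 (hmu t ht s hTI hts₁ x hxR)).2
    have h2 : θ s * softNorm δ (x - y) ≤ θ t * softNorm δ (x - y) := by
      gcongr
      · exact softNorm_nonneg _ _
      · exact hθa ht0.2
    linarith [hterm x y]
  -- interior maximum
  have hθt := hθ1 t ht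
  have h1 := doubling_interior hK hδ hH hsub hsup hθ hψ hψ' hβ.le ⟨ht0.1, htT⟩ ⟨hs0.1, hsT⟩
    (by linarith) (fun t' ht' s' hs' x' y' => hmax (t', s', x', y') ⟨ht', hs', trivial⟩)
  -- The competitor `(t, s, y, y)` leaves `w` unchanged, so only `u` is compared with itself. The
  -- term `1 / 2 * ‖x - y‖` comes from `β ≤ 1 / 2`.
  have h2 := hint t ⟨ht0.1, htT⟩ x y (by
    have h := hmax (t, s, y, y) ⟨ht, hs, trivial⟩
    simp only [F, sub_self, softNorm_zero hδ.le] at h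
    have h3 := softNorm_le_add 1 y x
    have h4 : β * softNorm 1 y ≤ β * (softNorm 1 x + ‖y - x‖) := by gcongr
    have h5 : β * ‖y - x‖ ≤ 1 / 2 * ‖y - x‖ := by gcongr
    rw [norm_sub_rev y x] at h4 h5
    linarith)
  have h3 : K * (1 + θ t) * |t - s| ≤ K * (1 + θ 0) * η := by
    gcongr
    exact hθa ht.1
  have h4 : 0 < σ / T := by positivity
  linarith

/-- **Comparison by doubling of variables.** -/
theorem doubling (hT : 0 < T) (hK : 0 ≤ K) (hδ : 0 < δ) (hH : IsLipHam H T K)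
    (hu : IsBddCont T u) (hw : IsBddCont T w)
    (hsub : IsViscositySub H T u) (hsup : IsApproxSuper H T δ e w)
    (hθ : ContDiff ℝ 1 θ) (hθa : Antitone θ) (hθ1 : ∀ t ∈ Icc 0 T, 1 ≤ θ t) (hl : 0 ≤ lam₀)
    (hint : ∀ t ∈ Ioo 0 T, ∀ x y,
      θ t * (softNorm δ (x - y) - δ) - 1 / 2 * ‖x - y‖ ≤ u t x - u t y →
      K * (1 + θ t) * ‖x - y‖ + deriv θ t * softNorm δ (x - y) + e (θ t) ≤ lam₀)
    (hterm : ∀ x y, u T x - w T y ≤ θ T * softNorm δ (x - y)) :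
    ∀ t ∈ Icc 0 T, ∀ x y, u t x - w t y ≤ θ t * softNorm δ (x - y) + lam₀ * (T - t) := by
  intro t ht x y
  have hc : ∀ {v : ℝ → E d → ℝ}, IsBddCont T v → ∀ x, ContinuousOn (fun t => v t x) (Icc 0 T) :=
    fun hv x => hv.1.comp (f := fun t => (t, x)) (by fun_prop) fun t ht => ⟨ht, trivial⟩
  have hcl : closure (Ioo 0 T) = Icc 0 T := closure_Ioo hT.ne
  have hθc := hθ.continuous
  refine le_on_closure (s := Ioo 0 T) (f := fun t => u t x - w t y)
    (g := fun t => θ t * softNorm δ (x - y) + lam₀ * (T - t))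
    (fun t ht => doubling_Ioo hT hK hδ hH hu hw hsub hsup hθ hθa hθ1 hl hint hterm t ht x y)
    ?_ (by fun_prop) (hcl ▸ ht)
  rw [hcl]
  exact (hc hu x).sub (hc hw y)

end Doubling

end HJB

namespace HJB

variable {d m : ℕ}

/-! ### Regularity of the Hamiltonian -/

section Hamiltonian

variable {P : ControlProblem d m} {T N : ℝ} {K : ℝ≥0}

lemma Standing.exists_minimizer (hP : Standing P T K N) {t : ℝ} (ht : t ∈ Icc 0 T) (x p : E d) :
    ∃ a ∈ P.A, P.H t x p = P.preHamiltonian t x p a := by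
  obtain ⟨α, hα, -⟩ := hP.a2
  obtain ⟨h1, h2, -⟩ := hα t ht x p
  refine ⟨α t x p, h1, IsLeast.csInf_eq ⟨mem_image_of_mem _ h1, ?_⟩⟩
  rintro _ ⟨a, ha, rfl⟩
  exact h2 a ha

lemma Standing.H_le (hP : Standing P T K N) {t : ℝ} (ht : t ∈ Icc 0 T) (x p : E d) {a : E m}
    (ha : a ∈ P.A) : P.H t x p ≤ P.preHamiltonian t x p a := by
  obtain ⟨α, hα, -⟩ := hP.a2
  obtain ⟨-, h2, -⟩ := hα t ht x p
  refine csInf_le ⟨P.preHamiltonian t x p (α t x p), ?_⟩ (mem_image_of_mem _ ha)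
  rintro _ ⟨b, hb, rfl⟩
  exact h2 b hb

/-- Test the left infimum with the minimizer of the right one. Bounds on `H`, including those for
the scheme, thus reduce to a fixed control. -/
lemma Standing.H_le_H_add (hP : Standing P T K N) {t s : ℝ} (ht : t ∈ Icc 0 T) (hs : s ∈ Icc 0 T)
    {x y p p' : E d} {C : ℝ}
    (h : ∀ a ∈ P.A, P.preHamiltonian t x p a ≤ P.preHamiltonian s y p' a + C) :
    P.H t x p ≤ P.H s y p' + C := by
  obtain ⟨a, ha, he⟩ := hP.exists_minimizer hs y p'
  rw [he]
  exact (hP.H_le ht x p ha).trans (h a ha)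

lemma Standing.preHamiltonian_sub_le (hP : Standing P T K N) {t s : ℝ} (ht : t ∈ Icc 0 T)
    (hs : s ∈ Icc 0 T) (x y p : E d) {a : E m} (ha : a ∈ P.A) :
    P.preHamiltonian t x p a ≤
      P.preHamiltonian s y p a + K * (1 + ‖p‖) * (|t - s| + ‖x - y‖) := by
  have hz : ((t, x, a) : ℝ × E d × E m) ∈ Icc 0 T ×ˢ univ ×ˢ P.A := ⟨ht, trivial, ha⟩
  have hz' : ((s, y, a) : ℝ × E d × E m) ∈ Icc 0 T ×ˢ univ ×ˢ P.A := ⟨hs, trivial, ha⟩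
  have hd : dist ((t, x, a) : ℝ × E d × E m) (s, y, a) ≤ |t - s| + ‖x - y‖ := by
    simp only [Prod.dist_eq, Real.dist_eq, dist_self, dist_eq_norm x y]
    have := abs_nonneg (t - s)
    have := norm_nonneg (x - y)
    refine max_le (by linarith) (max_le (by linarith) (by positivity))
  have hc := hP.a1.c_lip.dist_le_mul _ hz _ hz'
  have hf := hP.a1.f_lip.dist_le_mul _ hz _ hz'
  simp only [Real.dist_eq] at hc
  simp only [dist_eq_norm (P.f t x a)] at hf
  have hKd : K * dist ((t, x, a) : ℝ × E d × E m) (s, y, a) ≤ K * (|t - s| + ‖x - y‖) := by gcongr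
  have h1 : inner ℝ p (P.f t x a) - inner ℝ p (P.f s y a) ≤ ‖p‖ * ‖P.f t x a - P.f s y a‖ := by
    rw [← inner_sub_right]
    exact real_inner_le_norm _ _
  have h2 : ‖p‖ * ‖P.f t x a - P.f s y a‖ ≤ ‖p‖ * (K * (|t - s| + ‖x - y‖)) := by
    gcongr
    exact hf.trans hKd
  unfold ControlProblem.preHamiltonian
  linarith [(abs_le.1 hc).2]

lemma Standing.isLipHam (hP : Standing P T K N) : IsLipHam P.H T K where
  lip_tx t ht s hs x y p := by
    have h1 := hP.H_le_H_add ht hs fun a ha => hP.preHamiltonian_sub_le ht hs x y p ha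
    have h2 := hP.H_le_H_add hs ht fun a ha => hP.preHamiltonian_sub_le hs ht y x p ha
    rw [abs_sub_comm s t, norm_sub_rev y x] at h2
    exact abs_le.2 ⟨by linarith, by linarith⟩
  lip_p t ht x p p' := by
    have key : ∀ p p' : E d, P.H t x p ≤ P.H t x p' + K * ‖p - p'‖ := fun p p' =>
      hP.H_le_H_add ht ht fun a ha => by
        have h1 : inner ℝ (p - p') (P.f t x a) ≤ ‖p - p'‖ * ‖P.f t x a‖ := real_inner_le_norm _ _
        have h2 : ‖p - p'‖ * ‖P.f t x a‖ ≤ ‖p - p'‖ * K := by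
          gcongr
          exact hP.a1.f_bound t ht x a ha
        rw [inner_sub_left] at h1
        unfold ControlProblem.preHamiltonian
        linarith
    have h1 := key p p'
    have h2 := key p' p
    rw [norm_sub_rev p' p] at h2
    exact abs_le.2 ⟨by linarith, by linarith⟩

end Hamiltonian

/-! ### Exchanging sub- and supersolutions by a change of sign -/

section Reflection

variable {H : ℝ → E d → E d → ℝ} {T K δ : ℝ} {u : ℝ → E d → ℝ}

/-- The Hamiltonian of the equation solved by `-u` when `u` solves the one of `H`. -/
def negHam (H : ℝ → E d → E d → ℝ) : ℝ → E d → E d → ℝ := fun t x p => -H t x (-p)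

/-- The supersolution property for `∂_t u + H(t, x, ∇u) = 0`, posed backward in time. -/
def IsViscositySuper (H : ℝ → E d → E d → ℝ) (T : ℝ) (u : ℝ → E d → ℝ) : Prop :=
  ∀ φ : ℝ × E d → ℝ, ContDiff ℝ 1 φ → ∀ t ∈ Ioo 0 T, ∀ x,
    IsLocalMin (fun z : ℝ × E d => u z.1 z.2 - φ z) (t, x) →
    deriv (fun s => φ (s, x)) t + H t x (gradient (fun y => φ (t, y)) x) ≤ 0

lemma gradient_fun_neg (f : E d → ℝ) (x : E d) : gradient (fun y => -f y) x = -gradient f x := by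
  rw [gradient, gradient, fderiv_fun_neg, map_neg]

lemma IsLipHam.neg (hH : IsLipHam H T K) : IsLipHam (negHam H) T K where
  lip_tx t ht s hs x y p := by
    have := hH.lip_tx t ht s hs x y (-p)
    rwa [norm_neg, ← abs_neg, neg_sub, ← neg_sub_neg] at this
  lip_p t ht x p p' := by
    have := hH.lip_p t ht x (-p) (-p')
    rwa [← neg_sub', norm_neg, ← abs_neg, neg_sub, ← neg_sub_neg] at this

lemma IsViscositySuper.neg (h : IsViscositySuper H T u) :
    IsViscositySub (negHam H) T (fun t x => -u t x) := by
  intro φ hφ t ht x hmax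
  have := h (fun z => -φ z) hφ.neg t ht x (by
    refine hmax.neg.congr (Filter.Eventually.of_forall fun z => ?_)
    simp; ring)
  rw [deriv.fun_neg, gradient_fun_neg] at this
  simp only [negHam]
  linarith

lemma IsBddCont.neg (hu : IsBddCont T u) : IsBddCont T (fun t x => -u t x) :=
  ⟨hu.1.neg, hu.2.imp fun B hB t ht x => by simpa using hB t ht x⟩

lemma IsViscositySuper.isApproxSuper (hδ : 0 < δ) (h : IsViscositySuper H T u) :
    IsApproxSuper H T δ (fun _ => 0) u := by
  intro a ha ϑ _ x₀ s hs y hmin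
  have hrev : ∀ z, softNorm δ (x₀ - z) = softNorm δ (z - x₀) := fun z => by
    rw [← neg_sub, softNorm_neg]
  have hg : softGrad δ (x₀ - y) = -softGrad δ (y - x₀) := by
    rw [softGrad, softGrad, hrev, ← smul_neg, neg_sub]
  have h1 := h (fun z => a z.1 - ϑ * softNorm δ (z.2 - x₀)) (by
      have a1 : ContDiff ℝ 1 fun z : ℝ × E d => softNorm δ (z.2 - x₀) :=
        (contDiff_softNorm hδ).comp (contDiff_snd.sub contDiff_const)
      have a3 : ContDiff ℝ 1 fun z : ℝ × E d => a z.1 := ha.comp contDiff_fst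
      fun_prop) s hs y (by
      have : ∀ᶠ z : ℝ × E d in nhds (s, y), z.1 ∈ Icc 0 T :=
        continuous_fst.continuousAt.eventually (Icc_mem_nhds hs.1 hs.2)
      filter_upwards [this] with z hz
      have := hmin z.1 hz z.2
      rw [hrev, hrev] at this
      linarith)
  have hgrad : HasGradientAt (fun z => a s - ϑ * softNorm δ (z - x₀))
      (-(ϑ • softGrad δ (y - x₀))) y := by
    have b1 := hasGradientAt_comp_sub (hasGradientAt_softNorm hδ (y - x₀))
    rw [hasGradientAt_iff_hasFDerivAt] at b1 ⊢
    simpa using (b1.const_mul ϑ).const_sub (a s)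
  rw [hgrad.gradient] at h1
  simp only [deriv_sub_const_fun] at h1
  rwa [hg, smul_neg]

end Reflection

/-! ### Monotonicity and consistency of the scheme -/

section Scheme

variable {P : ControlProblem d m} {T N h δ : ℝ} {K : ℝ≥0}

/-- The increments `Dp` and `Dm` carry the weights `(2 N + f) / (2 h)` and `(2 N - f) / (2 h)`. Both
are nonnegative and they sum to `2 N / h`, which gives the error `2 N κ / h`. -/
lemma upwind_coordinate_le {f p Dp Dm κ : ℝ} (hh : 0 < h) (hf : |f| ≤ 2 * N)
    (hp : h * p - κ ≤ Dp) (hm : -(h * p) - κ ≤ Dm) :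
    f * p - 2 * N * κ / h ≤ f * ((Dp - Dm) / (2 * h)) + N * h * ((Dp + Dm) / h ^ 2) := by
  have hf' := abs_le.1 hf
  have h1 : 0 ≤ (2 * N + f) * (Dp - (h * p - κ)) := mul_nonneg (by linarith) (by linarith)
  have h2 : 0 ≤ (2 * N - f) * (Dm - (-(h * p) - κ)) := mul_nonneg (by linarith) (by linarith)
  have h3 : f * ((Dp - Dm) / (2 * h)) + N * h * ((Dp + Dm) / h ^ 2) - (f * p - 2 * N * κ / h) =
      ((2 * N + f) * (Dp - (h * p - κ)) + (2 * N - f) * (Dm - (-(h * p) - κ))) / (2 * h) := by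
    field_simp; ring
  have h4 : 0 ≤ ((2 * N + f) * (Dp - (h * p - κ)) + (2 * N - f) * (Dm - (-(h * p) - κ))) / (2 * h) :=
    by positivity
  linarith

lemma abs_apply_le_norm (z : E d) (i : Fin d) : |z i| ≤ ‖z‖ := by
  simpa using PiLp.norm_apply_le z i

lemma Standing.abs_f_apply_le (hP : Standing P T K N) {t : ℝ} (ht : t ∈ Icc 0 T) (x : E d) {a : E m}
    (ha : a ∈ P.A) (i : Fin d) : |P.f t x a i| ≤ 2 * N := by
  have := hP.f_le t ht x a ha
  linarith [abs_apply_le_norm (P.f t x a) i]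

lemma inner_eq_sum_mul (p z : E d) : inner ℝ p z = ∑ i, z i * p i := by
  simp [PiLp.inner_apply]

/-- The numerical viscosity does not depend on the control, so it can be taken inside the minimum
and split by coordinate. -/
lemma preHamiltonian_add_laplacian (P : ControlProblem d m) (N h t : ℝ) (φ : E d → ℝ) (x : E d)
    (a : E m) :
    P.preHamiltonian t x (discGrad h φ x) a + N * h * discLaplacian h φ x =
      P.c t x a + ∑ i, (P.f t x a i *
        (((φ (x + h • EuclideanSpace.single i (1 : ℝ)) - φ x) -
          (φ (x - h • EuclideanSpace.single i (1 : ℝ)) - φ x)) / (2 * h)) +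
        N * h * (((φ (x + h • EuclideanSpace.single i (1 : ℝ)) - φ x) +
          (φ (x - h • EuclideanSpace.single i (1 : ℝ)) - φ x)) / h ^ 2)) := by
  rw [ControlProblem.preHamiltonian, inner_eq_sum_mul, discLaplacian, Finset.sum_add_distrib,
    Finset.mul_sum, ← add_assoc]
  congr 1
  · congr 1
    refine Finset.sum_congr rfl fun i _ => ?_
    simp [discGrad]
  · refine Finset.sum_congr rfl fun i _ => ?_
    congr 2; ring

/-- Monotonicity of the scheme, compared from below with an affine function. -/
lemma Standing.le_scheme (hP : Standing P T K N) (hh : 0 < h) {t : ℝ} (ht : t ∈ Icc 0 T)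
    {φ : E d → ℝ} {x p : E d} {κ : ℝ}
    (hp : ∀ i, h * p i - κ ≤ φ (x + h • EuclideanSpace.single i (1 : ℝ)) - φ x)
    (hm : ∀ i, -(h * p i) - κ ≤ φ (x - h • EuclideanSpace.single i (1 : ℝ)) - φ x) :
    P.H t x p - d * (2 * N * κ / h) ≤ P.H t x (discGrad h φ x) + N * h * discLaplacian h φ x := by
  have := hP.H_le_H_add (p := p) (p' := discGrad h φ x) (x := x) (y := x)
    (C := N * h * discLaplacian h φ x + d * (2 * N * κ / h)) ht ht fun a ha => by
      rw [← add_assoc, preHamiltonian_add_laplacian, ControlProblem.preHamiltonian,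
        inner_eq_sum_mul, add_assoc]
      gcongr
      have hs : (d : ℝ) * (2 * N * κ / h) = ∑ _i : Fin d, 2 * N * κ / h := by simp
      rw [hs, ← Finset.sum_add_distrib]
      refine Finset.sum_le_sum fun i _ => ?_
      have := upwind_coordinate_le hh (hP.abs_f_apply_le ht x ha i) (hp i) (hm i)
      linarith
  linarith

/-- Monotonicity of the scheme, compared from above with an affine function. -/
lemma Standing.scheme_le (hP : Standing P T K N) (hh : 0 < h) {t : ℝ} (ht : t ∈ Icc 0 T)
    {φ : E d → ℝ} {x p : E d} {κ : ℝ}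
    (hp : ∀ i, φ (x + h • EuclideanSpace.single i (1 : ℝ)) - φ x ≤ h * p i + κ)
    (hm : ∀ i, φ (x - h • EuclideanSpace.single i (1 : ℝ)) - φ x ≤ -(h * p i) + κ) :
    P.H t x (discGrad h φ x) + N * h * discLaplacian h φ x ≤ P.H t x p + d * (2 * N * κ / h) := by
  have := hP.H_le_H_add (p := discGrad h φ x) (p' := p) (x := x) (y := x)
    (C := d * (2 * N * κ / h) - N * h * discLaplacian h φ x) ht ht fun a ha => by
      have key : P.preHamiltonian t x (discGrad h φ x) a + N * h * discLaplacian h φ x ≤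
          P.preHamiltonian t x p a + d * (2 * N * κ / h) := by
        rw [preHamiltonian_add_laplacian, ControlProblem.preHamiltonian,
          inner_eq_sum_mul, add_assoc]
        gcongr
        have hs : (d : ℝ) * (2 * N * κ / h) = ∑ _i : Fin d, 2 * N * κ / h := by simp
        rw [hs, ← Finset.sum_add_distrib]
        refine Finset.sum_le_sum fun i _ => ?_
        have := upwind_coordinate_le (p := -p i) (κ := κ) hh (hP.abs_f_apply_le ht x ha i)
          (Dp := -(φ (x + h • EuclideanSpace.single i (1 : ℝ)) - φ x))
          (Dm := -(φ (x - h • EuclideanSpace.single i (1 : ℝ)) - φ x))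
          (by linarith [hp i]) (by linarith [hm i])
        rw [← neg_add, ← neg_sub', neg_div, neg_div] at this
        linarith
      linarith
  linarith

variable {vh : ℝ → E d → ℝ}

/-- At the contact point `w` lies above a translate of `-ϑ softNorm`, whose Taylor remainder is
controlled by `softNorm_add_le`. -/
lemma contact_increment {ϑ : ℝ} (hδ : 0 < δ) (hϑ : 0 ≤ ϑ) {x₀ y : E d} {w : E d → ℝ}
    (hmin : ∀ y', w y + ϑ * softNorm δ (x₀ - y) ≤ w y' + ϑ * softNorm δ (x₀ - y')) (z : E d) :
    inner ℝ (ϑ • softGrad δ (x₀ - y)) z - ϑ * (‖z‖ ^ 2 / (2 * δ)) ≤ w (y + z) - w y := by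
  have h1 := hmin (y + z)
  have h2 := softNorm_add_le hδ (x₀ - y) (-z)
  rw [inner_neg_right, norm_neg, ← sub_eq_add_neg, sub_sub] at h2
  have h3 := mul_le_mul_of_nonneg_left h2 hϑ
  rw [real_inner_smul_left]
  linarith

lemma contact_increment_axis {ϑ : ℝ} (hδ : 0 < δ) (hϑ : 0 ≤ ϑ) {x₀ y : E d} {w : E d → ℝ}
    (hmin : ∀ y', w y + ϑ * softNorm δ (x₀ - y) ≤ w y' + ϑ * softNorm δ (x₀ - y')) (h : ℝ)
    (i : Fin d) :
    h * (ϑ • softGrad δ (x₀ - y)) i - ϑ * h ^ 2 / (2 * δ) ≤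
        w (y + h • EuclideanSpace.single i (1 : ℝ)) - w y ∧
      -(h * (ϑ • softGrad δ (x₀ - y)) i) - ϑ * h ^ 2 / (2 * δ) ≤
        w (y - h • EuclideanSpace.single i (1 : ℝ)) - w y := by
  have h1 := contact_increment hδ hϑ hmin (h • EuclideanSpace.single i (1 : ℝ))
  have h2 := contact_increment hδ hϑ hmin (-(h • EuclideanSpace.single i (1 : ℝ)))
  rw [← sub_eq_add_neg] at h2
  simp only [inner_neg_right, norm_neg, inner_smul_right, EuclideanSpace.inner_single_right,
    norm_smul, PiLp.norm_single, norm_one, mul_one, Real.norm_eq_abs, sq_abs, one_mul,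
    conj_trivial] at h1 h2
  rw [mul_div_assoc]
  exact ⟨h1, h2⟩

lemma IsSchemeSolution.time_derivative (hv : IsSchemeSolution P T N h vh) {a : ℝ → ℝ}
    (ha : ContDiff ℝ 1 a) {s : ℝ} (hs : s ∈ Ioo 0 T) {y : E d}
    (hext : IsLocalExtr (fun τ => vh τ y - a τ) s) :
    deriv a s + P.H s y (discGrad h (vh s) y) = -N * h * discLaplacian h (vh s) y := by
  obtain ⟨u', hu', he⟩ := hv.eqn s hs y
  have := hext.hasDerivAt_eq_zero (hu'.sub (ha.differentiable one_ne_zero s).hasDerivAt)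
  rw [← he]; linarith

/-- Contact in time identifies `∂_t vh` with `deriv a s`. Contact in space bounds the axis
increments up to `κ = ϑ h² / (2 δ)`, and monotonicity turns this into the error `d * (2 N κ / h)`.
-/
lemma IsSchemeSolution.isApproxSuper (hP : Standing P T K N) (hh : 0 < h) (hδ : 0 < δ)
    (hv : IsSchemeSolution P T N h vh) :
    IsApproxSuper P.H T δ (fun ϑ => d * (N * h * ϑ / δ)) vh := by
  intro a ha ϑ hϑ x₀ s hs y hmin
  have hsI := Ioo_subset_Icc_self hs
  have h1 := hv.time_derivative ha hs (y := y) (Or.inl (by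
    filter_upwards [Icc_mem_nhds hs.1 hs.2] with τ hτ
    linarith [hmin τ hτ y]))
  have h2 := contact_increment_axis (w := vh s) hδ hϑ
    (fun y' => by linarith [hmin s hsI y']) h
  have h3 := hP.le_scheme hh hsI (fun i => (h2 i).1) (fun i => (h2 i).2)
  have h4 : 2 * N * (ϑ * h ^ 2 / (2 * δ)) / h = N * h * ϑ / δ := by field_simp
  rw [h4] at h3
  linarith

lemma IsSchemeSolution.neg_isApproxSuper (hP : Standing P T K N) (hh : 0 < h) (hδ : 0 < δ)
    (hv : IsSchemeSolution P T N h vh) :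
    IsApproxSuper (negHam P.H) T δ (fun ϑ => d * (N * h * ϑ / δ)) (fun t x => -vh t x) := by
  intro a ha ϑ hϑ x₀ s hs y hmin
  have hsI := Ioo_subset_Icc_self hs
  have h1 := hv.time_derivative ha.neg hs (y := y) (Or.inr (by
    filter_upwards [Icc_mem_nhds hs.1 hs.2] with τ hτ
    have := hmin τ hτ y
    linarith))
  have h2 := contact_increment_axis (w := fun y => -vh s y) hδ hϑ
    (fun y' => by linarith [hmin s hsI y']) h
  simp only [neg_sub_neg] at h2
  have h3 := hP.scheme_le (φ := vh s) (x := y) (p := -(ϑ • softGrad δ (x₀ - y)))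
    (κ := ϑ * h ^ 2 / (2 * δ)) hh hsI
    (fun i => by
      rw [PiLp.neg_apply, mul_neg, ← neg_le_neg_iff, neg_sub, neg_add', neg_neg]
      exact (h2 i).1)
    (fun i => by
      rw [PiLp.neg_apply, mul_neg, neg_neg, ← neg_le_neg_iff, neg_sub, neg_add']
      exact (h2 i).2)
  have h4 : 2 * N * (ϑ * h ^ 2 / (2 * δ)) / h = N * h * ϑ / δ := by field_simp
  rw [h4] at h3
  rw [deriv.fun_neg] at h1
  simp only [negHam]
  linarith

end Scheme

/-! ### Lipschitz bound and error bound -/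

section Estimates

variable {P : ControlProblem d m} {T N : ℝ} {K : ℝ≥0} {v : ℝ → E d → ℝ}

lemma Standing.q_sub_le (hP : Standing P T K N) (x y : E d) : P.q x - P.q y ≤ K * ‖x - y‖ := by
  have := hP.a1.q_lip.dist_le_mul x y
  rw [Real.dist_eq, dist_eq_norm] at this
  exact (le_abs_self _).trans this

/-- The Lipschitz bound for the viscosity solution. -/
theorem IsViscositySolution.sub_le (hT : 0 < T) (hP : Standing P T K N)
    (hv : IsViscositySolution P T v) {t : ℝ} (ht : t ∈ Icc 0 T) (x y : E d) :
    v t x - v t y ≤ (K + 1) * Real.exp (2 * K * T) * ‖x - y‖ := by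
  -- Since `θ ≥ 1`, `K (1 + θ) ≤ 2 K θ = -θ'`, so the interior condition holds with `lam₀ = 0`. The
  -- factor `K + 1` dominates both `1` and the Lipschitz constant of `q`.
  set θ : ℝ → ℝ := fun t => (K + 1) * Real.exp (2 * K * (T - t)) with hθ
  have hK : (0 : ℝ) ≤ K := K.2
  have hd : ∀ t, HasDerivAt θ (-(2 * K * θ t)) t := fun t => by
    have := ((((hasDerivAt_id t).const_sub T).const_mul (2 * K : ℝ)).exp).const_mul (K + 1 : ℝ)
    refine HasDerivAt.congr_deriv this ?_
    simp [hθ]; ring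
  have hθK : ∀ t ∈ Icc 0 T, K + 1 ≤ θ t := fun t ht => by
    have : 0 ≤ 2 * K * (T - t) := mul_nonneg (by positivity) (by linarith [ht.2])
    have := Real.one_le_exp this
    simp only [hθ]
    nlinarith
  have hθ0 : ∀ t, 0 ≤ θ t := fun t => by simp only [hθ]; positivity
  have hbound : ∀ δ > 0, v t x - v t y ≤ θ t * softNorm δ (x - y) := fun δ hδ => by
    have := doubling (u := v) (w := v) (θ := θ) (lam₀ := 0) (e := fun _ => 0) hT hK hδ hP.isLipHam
      hv.bddCont hv.bddCont hv.sub (IsViscositySuper.isApproxSuper hδ hv.super)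
      (by fun_prop) (antitone_of_deriv_nonpos (fun t => (hd t).differentiableAt) fun t => by
        rw [(hd t).deriv]
        have := hθ0 t
        have : 0 ≤ 2 * K * θ t := by positivity
        linarith)
      (fun t ht => by linarith [hθK t ht]) le_rfl
      (fun t ht x y _ => by
        rw [(hd t).deriv]
        have h1 := hθK t (Ioo_subset_Icc_self ht)
        have h2 : K * (1 + θ t) * ‖x - y‖ ≤ K * (2 * θ t) * softNorm δ (x - y) := by
          gcongr
          · linarith
          · exact norm_le_softNorm _ _
        linarith)
      (fun x y => by
        rw [hv.terminal, hv.terminal]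
        refine (hP.q_sub_le x y).trans ?_
        have h1 := hθK T ⟨hT.le, le_rfl⟩
        gcongr
        · linarith
        · exact norm_le_softNorm _ _) t ht x y
    simpa using this
  have hlim : v t x - v t y ≤ θ t * ‖x - y‖ := by
    refine le_of_forall_pos_le_add fun ε hε => ?_
    have hθt : 0 < θ t := by linarith [hθK t ht]
    have h1 := hbound (ε / θ t) (by positivity)
    have h2 := softNorm_le (δ := ε / θ t) (by positivity) (x - y)
    calc _ ≤ _ := h1
      _ ≤ θ t * (‖x - y‖ + ε / θ t) := by gcongr
      _ = _ := by field_simp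
  refine hlim.trans ?_
  have : Real.exp (2 * K * (T - t)) ≤ Real.exp (2 * K * T) := by
    gcongr; linarith [ht.1]
  simp only [hθ]
  gcongr

/-- One-sided error bound, for an arbitrary Hamiltonian and an approximate supersolution. -/
lemma error_le_of_approxSuper {H : ℝ → E d → E d → ℝ} {K G N h : ℝ} {u w : ℝ → E d → ℝ}
    (hT : 0 < T) (hK : 0 ≤ K) (hG : 0 ≤ G) (hN : 0 ≤ N) (hh : 0 < h) (hH : IsLipHam H T K)
    (hu : IsBddCont T u) (hw : IsBddCont T w) (hsub : IsViscositySub H T u)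
    (hsup : IsApproxSuper H T √h (fun ϑ => d * (N * h * ϑ / √h)) w)
    (hL : ∀ t ∈ Icc 0 T, ∀ x y, u t x - u t y ≤ G * ‖x - y‖)
    (hterm : ∀ x y, u T x - w T y ≤ K * ‖x - y‖) {t : ℝ} (ht : t ∈ Icc 0 T) (x : E d) :
    u t x - w t x ≤ (2 * G + K + 1 + (2 * K * (2 * G + K + 2) + d * N * (2 * G + K + 1)) * T) * √h := by
  have hs : 0 < √h := Real.sqrt_pos.2 hh
  -- Chosen so that `θ / 2 ≥ G + 1 / 2`, which absorbs the Lipschitz term and the localization term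
  -- and leaves `‖x - y‖ ≤ 2 √h`; also `θ ≥ K` for the terminal data.
  set θ := 2 * G + K + 1 with hθ
  have hθ0 : 0 < θ := by positivity
  have h1 := doubling (u := u) (w := w) (θ := fun _ => θ) (δ := √h)
    (lam₀ := (2 * K * (2 * G + K + 2) + d * N * θ) * √h) hT hK hs hH hu hw hsub hsup
    contDiff_const antitone_const (fun t _ => by linarith) (by positivity)
    (fun t ht x y hxy => by
      have h2 := hxy.trans (hL t (Ioo_subset_Icc_self ht) x y)
      have h3 := norm_le_softNorm √h (x - y)
      have h4 : θ * ‖x - y‖ ≤ θ * softNorm √h (x - y) := by gcongr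
      have h5 : ‖x - y‖ ≤ 2 * √h := by
        have : 0 ≤ K * ‖x - y‖ := by positivity
        have h6 : θ / 2 * ‖x - y‖ ≤ θ / 2 * (2 * √h) := by rw [hθ] at *; linarith
        exact le_of_mul_le_mul_left h6 (by positivity)
      have h6 : K * (1 + θ) * ‖x - y‖ ≤ K * (1 + θ) * (2 * √h) := by gcongr
      have h7 : N * h * θ / √h = N * θ * √h := by
        rw [div_eq_iff hs.ne', mul_assoc (N * θ), Real.mul_self_sqrt hh.le]; ring
      simp only [deriv_const, zero_mul, h7]
      rw [hθ] at *
      linarith)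
    (fun x y => (hterm x y).trans (by
      gcongr
      · linarith
      · exact norm_le_softNorm _ _)) t ht x x
  rw [sub_self, softNorm_zero hs.le] at h1
  have h2 : (2 * K * (2 * G + K + 2) + d * N * θ) * √h * (T - t) ≤
      (2 * K * (2 * G + K + 2) + d * N * θ) * √h * T := by
    gcongr
    linarith [ht.1]
  linarith

/-- The error bound in terms of a spatial Lipschitz constant `G` of the viscosity solution. -/
theorem IsSchemeSolution.error_le {h G : ℝ} {vh : ℝ → E d → ℝ} (hT : 0 < T)
    (hP : Standing P T K N) (hv : IsViscositySolution P T v) (hh : 0 < h)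
    (hvh : IsSchemeSolution P T N h vh) (hG : 0 ≤ G)
    (hL : ∀ t ∈ Icc 0 T, ∀ x y, v t x - v t y ≤ G * ‖x - y‖) {t : ℝ} (ht : t ∈ Icc 0 T) (x : E d) :
    |v t x - vh t x| ≤
      (2 * G + K + 1 + (2 * K * (2 * G + K + 2) + d * N * (2 * G + K + 1)) * T) * √h := by
  have hN : 0 ≤ N := by linarith [hP.one_le]
  have hs : 0 < √h := Real.sqrt_pos.2 hh
  have h1 := error_le_of_approxSuper hT K.2 hG hN hh hP.isLipHam hv.bddCont hvh.bddCont hv.sub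
    (hvh.isApproxSuper hP hh hs) hL
    (fun x y => by rw [hv.terminal, hvh.terminal]; exact hP.q_sub_le x y) ht x
  have h2 := error_le_of_approxSuper hT K.2 hG hN hh hP.isLipHam.neg hv.bddCont.neg
    hvh.bddCont.neg (IsViscositySuper.neg hv.super) (hvh.neg_isApproxSuper hP hh hs)
    (fun t ht x y => by rw [neg_sub_neg, norm_sub_rev]; exact hL t ht y x)
    (fun x y => by
      rw [hv.terminal, hvh.terminal, neg_sub_neg, norm_sub_rev]
      exact hP.q_sub_le y x) ht x
  rw [neg_sub_neg] at h2
  exact abs_sub_le_iff.2 ⟨h1, h2⟩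

end Estimates

end HJB

/-! ### From the essential supremum of the gradient to a Lipschitz constant -/

namespace HJB

variable {d : ℕ}

lemma norm_gradient_le {f : E d → ℝ} {L : ℝ≥0} (hf : LipschitzWith L f) (x : E d) :
    ‖gradient f x‖ ≤ L := by
  rw [gradient, LinearIsometryEquiv.norm_map]
  exact norm_fderiv_le_of_lipschitz ℝ hf

lemma gradSupNorm_le {T : ℝ} {v : ℝ → E d → ℝ} {L : ℝ≥0}
    (hv : ∀ t ∈ Icc 0 T, LipschitzWith L (v t)) : gradSupNorm T v ≤ L := by
  rw [gradSupNorm, eLpNorm_exponent_top]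
  refine eLpNormEssSup_le_of_ae_bound (C := (L : ℝ)) ?_ |>.trans (by simp)
  filter_upwards [ae_restrict_mem (measurableSet_Icc.prod MeasurableSet.univ)] with z hz
  exact norm_gradient_le (hv _ hz.1) z.2

/-- A property that holds almost everywhere holds almost everywhere along almost every line of a
given direction. -/
lemma ae_ae_add_smul {p : E d → Prop} (hp : ∀ᵐ x, p x) (w : E d) :
    ∀ᵐ x : E d, ∀ᵐ s : ℝ, p (x + s • w) := by
  obtain ⟨S, hS, hSm, hS0⟩ := exists_measurable_superset_of_null (ae_iff.1 hp)
  have hm : MeasurableSet {z : E d × ℝ | z.1 + z.2 • w ∈ Sᶜ} := by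
    refine hSm.compl.preimage ?_
    fun_prop
  have h : ∀ᵐ x : E d, ∀ᵐ s : ℝ, x + s • w ∈ Sᶜ := by
    -- After exchanging the quantifiers `s` is fixed, and a translate of a null set is null.
    refine (Measure.ae_ae_comm (p := fun x s => x + s • w ∈ Sᶜ) hm).2 ?_
    refine Filter.Eventually.of_forall fun s => ?_
    have := (measurePreserving_add_right (volume : Measure (E d)) (s • w)).quasiMeasurePreserving.ae
      (measure_eq_zero_iff_ae_notMem.1 hS0)
    exact this
  filter_upwards [h] with x hx
  filter_upwards [hx] with s hs
  by_contra hc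
  exact hs (hS hc)

/-- A Lipschitz function whose gradient is almost everywhere bounded by `G` is `G`-Lipschitz. -/
lemma sub_le_of_ae_norm_gradient_le {f : E d → ℝ} {L : ℝ≥0} (hf : LipschitzWith L f) {G : ℝ}
    (hG : ∀ᵐ x, ‖gradient f x‖ ≤ G) (x y : E d) : f x - f y ≤ G * ‖x - y‖ := by
  set w := x - y with hw
  -- Rademacher's theorem is essential: `gradient` is `0` by default where `f` is not
  -- differentiable, so the bound alone says nothing there.
  have hae : ∀ᵐ z, DifferentiableAt ℝ f z ∧ ‖gradient f z‖ ≤ G := hf.ae_differentiableAt.and hG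
  have key : ∀ᵐ z : E d, f (z + w) - f z ≤ G * ‖w‖ := by
    filter_upwards [ae_ae_add_smul hae w] with z hz
    have hg : LipschitzWith (L * ‖w‖₊) fun s : ℝ => f (z + s • w) := by
      refine hf.comp (LipschitzWith.of_dist_le_mul fun a b => ?_)
      rw [dist_add_left, dist_eq_norm, ← sub_smul, norm_smul, mul_comm, coe_nnnorm, dist_eq_norm]
    have hac : AbsolutelyContinuousOnInterval (fun s : ℝ => f (z + s • w)) 0 1 :=
      (hg.lipschitzOnWith (s := uIcc 0 1)).absolutelyContinuousOnInterval
    have h1 := hac.integral_deriv_eq_sub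
    simp only [one_smul, zero_smul, add_zero] at h1
    rw [← h1]
    have h2 : ∫ s in (0 : ℝ)..1, deriv (fun s : ℝ => f (z + s • w)) s ≤
        ∫ _ in (0 : ℝ)..1, G * ‖w‖ := by
      refine intervalIntegral.integral_mono_ae zero_le_one hac.intervalIntegrable_deriv
        intervalIntegrable_const ?_
      filter_upwards [hz] with s hs
      have hd : HasDerivAt (fun s : ℝ => z + s • w) w s := by
        simpa using ((hasDerivAt_id s).smul_const w).const_add z
      have := (hs.1.hasGradientAt.hasFDerivAt).comp_hasDerivAt s hd
      rw [show (fun s : ℝ => f (z + s • w)) = f ∘ fun s : ℝ => z + s • w from rfl, this.deriv,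
        InnerProductSpace.toDual_apply_apply]
      refine (real_inner_le_norm _ _).trans ?_
      gcongr
      exact hs.2
    simpa using h2
  have hc : Continuous fun z : E d => f (z + w) - f z := by
    have := hf.continuous
    fun_prop
  have hd := Measure.dense_of_ae key
  have := (isClosed_le hc continuous_const).closure_subset_iff.2 (fun z hz => hz) (hd y)
  simpa [hw] using this

/-- The essential supremum of the spatial gradient is a spatial Lipschitz constant. -/
lemma sub_le_gradSupNorm {T : ℝ} (hT : 0 < T) {v : ℝ → E d → ℝ} (hv : IsBddCont T v) {L : ℝ≥0}
    (hL : ∀ t ∈ Icc 0 T, LipschitzWith L (v t)) {t : ℝ} (ht : t ∈ Icc 0 T) (x y : E d) :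
    v t x - v t y ≤ (gradSupNorm T v).toReal * ‖x - y‖ := by
  set G := (gradSupNorm T v).toReal with hG
  -- `toReal` sends `⊤` to `0`, so finiteness must be known first.
  have hfin : gradSupNorm T v ≠ ⊤ := ((gradSupNorm_le hL).trans_lt ENNReal.coe_lt_top).ne
  have h1 : ∀ᵐ z : ℝ × E d ∂(volume.restrict (Icc 0 T ×ˢ univ)), ‖gradient (v z.1) z.2‖ ≤ G := by
    have := ae_le_eLpNormEssSup (μ := volume.restrict (Icc 0 T ×ˢ (univ : Set (E d))))
      (f := fun z : ℝ × E d => gradient (v z.1) z.2)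
    filter_upwards [this] with z hz
    rw [← eLpNorm_exponent_top] at hz
    have := ENNReal.toReal_mono hfin hz
    simpa using this
  rw [Measure.volume_eq_prod, ← Measure.prod_restrict, Measure.restrict_univ] at h1
  have h2 := Measure.ae_ae_of_ae_prod h1
  have h3 : ∀ᵐ s ∂(volume.restrict (Ioo 0 T)), v s x - v s y ≤ G * ‖x - y‖ := by
    have h4 := ae_mono (Measure.restrict_mono_set volume Ioo_subset_Icc_self) h2
    filter_upwards [h4, ae_restrict_mem measurableSet_Ioo] with s hs hsI
    exact sub_le_of_ae_norm_gradient_le (hL s (Ioo_subset_Icc_self hsI)) hs x y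
  have hc : ∀ x, ContinuousOn (fun t => v t x) (Icc 0 T) :=
    fun x => hv.1.comp (f := fun t => (t, x)) (by fun_prop) fun t ht => ⟨ht, trivial⟩
  have hcd : ContinuousOn (fun t => v t x - v t y) (Icc 0 T) := (hc x).sub (hc y)
  have hcl : closure (Ioo 0 T) = Icc 0 T := closure_Ioo hT.ne
  -- The times violating the bound form an open null set, hence there are none.
  have h5 : ∀ s ∈ Ioo 0 T, v s x - v s y ≤ G * ‖x - y‖ := by
    intro s hs
    by_contra! hlt
    have hopen : IsOpen (Ioo 0 T ∩ (fun t => v t x - v t y) ⁻¹' Ioi (G * ‖x - y‖)) :=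
      (hcd.mono Ioo_subset_Icc_self).isOpen_inter_preimage isOpen_Ioo isOpen_Ioi
    refine hopen.measure_ne_zero volume ⟨s, hs, hlt⟩ ?_
    rw [ae_restrict_iff' measurableSet_Ioo] at h3
    refine measure_mono_null ?_ (ae_iff.1 h3)
    rintro τ ⟨hτ, hτ'⟩ hc
    exact absurd (hc hτ) (not_le.2 hτ')
  exact le_on_closure (f := fun t => v t x - v t y) (g := fun _ => G * ‖x - y‖) h5 (hcl ▸ hcd)
    continuousOn_const (hcl ▸ ht)

end HJB

/-! ### The discrete heat semigroup and sharpness of the rate -/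

namespace HJB

variable {d : ℕ}

open scoped BoundedContinuousFunction

section OperatorExponential

variable {V : Type*} [NormedAddCommGroup V] [NormedSpace ℝ V]

/-- The exponential of a bounded operator. -/
def opExp (B : V →L[ℝ] V) : V →L[ℝ] V := NormedSpace.exp B

lemma opExp_zero : opExp (0 : V →L[ℝ] V) = 1 := NormedSpace.exp_zero

lemma hasSum_opExp_apply [CompleteSpace V] (B : V →L[ℝ] V) (f : V) :
    HasSum (fun n : ℕ => (n.factorial⁻¹ : ℝ) • (B ^ n) f) (opExp B f) := by
  have h := (NormedSpace.exp_series_hasSum_exp' (𝕂 := ℝ) B).mapL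
    (ContinuousLinearMap.apply ℝ V f)
  simpa [opExp] using h

lemma hasDerivAt_opExp_smul_apply [CompleteSpace V] (B : V →L[ℝ] V) (f : V) (τ : ℝ) :
    HasDerivAt (fun τ => opExp (τ • B) f) (B (opExp (τ • B) f)) τ := by
  have h := (hasDerivAt_exp_smul_const' (𝕂 := ℝ) B τ).clm_apply (hasDerivAt_const τ f)
  simpa [opExp] using h

variable {X : Type*} [TopologicalSpace X]

/-- Every term of the exponential series preserves nonnegativity. -/
lemma opExp_apply_nonneg {B : (X →ᵇ ℝ) →L[ℝ] (X →ᵇ ℝ)}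
    (hB : ∀ f : X →ᵇ ℝ, (∀ x, 0 ≤ f x) → ∀ x, 0 ≤ B f x) {f : X →ᵇ ℝ} (hf : ∀ x, 0 ≤ f x) (x : X) :
    0 ≤ opExp B f x := by
  have h := (hasSum_opExp_apply B f).mapL (BoundedContinuousFunction.evalCLM ℝ x)
  have hpow : ∀ n : ℕ, ∀ x, 0 ≤ (B ^ n) f x := by
    intro n
    induction n with
    | zero => simpa using hf
    | succ n ih => rw [pow_succ']; exact hB _ ih
  refine h.nonneg fun n => ?_
  simp only [map_smul, BoundedContinuousFunction.evalCLM_apply, smul_eq_mul]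
  exact mul_nonneg (by positivity) (hpow n x)

lemma opExp_apply_of_eigen {B : (X →ᵇ ℝ) →L[ℝ] (X →ᵇ ℝ)} {μ : ℝ} {f : X →ᵇ ℝ} (hB : B f = μ • f) :
    opExp B f = Real.exp μ • f := by
  have hpow : ∀ n : ℕ, (B ^ n) f = μ ^ n • f := by
    intro n
    induction n with
    | zero => simp
    | succ n ih => rw [pow_succ', mul_apply_eq_comp, ih, map_smul, hB, smul_smul, pow_succ]
  refine (hasSum_opExp_apply B f).unique ?_
  have := (NormedSpace.exp_series_hasSum_exp' (𝕂 := ℝ) μ).smul_const f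
  rw [← Real.exp_eq_exp_ℝ] at this
  simpa [hpow, smul_smul] using this

end OperatorExponential

/-- Translation of bounded continuous functions, as a bounded operator. -/
def translation (z : E d) : (E d →ᵇ ℝ) →L[ℝ] (E d →ᵇ ℝ) :=
  LinearMap.mkContinuous
    { toFun := fun f => f.compContinuous ⟨fun x => x + z, by fun_prop⟩
      map_add' := fun _ _ => rfl
      map_smul' := fun _ _ => rfl } 1 fun f => by
    rw [one_mul]
    exact f.norm_compContinuous_le _

@[simp]
lemma translation_apply (z : E d) (f : E d →ᵇ ℝ) (x : E d) : translation z f x = f (x + z) := rfl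

/-- The sum of the values at the `2 d` grid neighbours. -/
def neighbourSum (h : ℝ) : (E d →ᵇ ℝ) →L[ℝ] (E d →ᵇ ℝ) :=
  ∑ i, (translation (h • EuclideanSpace.single i (1 : ℝ)) +
    translation (-(h • EuclideanSpace.single i (1 : ℝ))))

lemma neighbourSum_apply (h : ℝ) (f : E d →ᵇ ℝ) (x : E d) :
    neighbourSum h f x = ∑ i, (f (x + h • EuclideanSpace.single i (1 : ℝ)) +
      f (x - h • EuclideanSpace.single i (1 : ℝ))) := by
  simp [neighbourSum, sub_eq_add_neg]

lemma discLaplacian_eq_neighbourSum (h : ℝ) (f : E d →ᵇ ℝ) (x : E d) :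
    discLaplacian h f x = (neighbourSum h f x - 2 * d * f x) / h ^ 2 := by
  have : (2 * d * f x : ℝ) = ∑ _i : Fin d, 2 * f x := by simp; ring
  rw [discLaplacian, neighbourSum_apply, this, ← Finset.sum_sub_distrib, Finset.sum_div]
  refine Finset.sum_congr rfl fun i _ => ?_
  ring

/-- The semigroup of the semi-discrete heat equation `∂_τ u = N h Δ^h u`. -/
def heatFlow (N h : ℝ) (f : E d →ᵇ ℝ) (τ : ℝ) : E d →ᵇ ℝ :=
  Real.exp (-(2 * d * N / h) * τ) • opExp (τ • ((N / h) • neighbourSum h)) f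

lemma heatFlow_zero (N h : ℝ) (f : E d →ᵇ ℝ) : heatFlow N h f 0 = f := by
  simp [heatFlow, opExp_zero]

lemma hasDerivAt_heatFlow (N h : ℝ) (f : E d →ᵇ ℝ) (τ : ℝ) :
    HasDerivAt (heatFlow N h f)
      ((N / h) • (neighbourSum h (heatFlow N h f τ) - (2 * d : ℝ) • heatFlow N h f τ)) τ := by
  have h1 := hasDerivAt_opExp_smul_apply ((N / h) • neighbourSum (d := d) h) f τ
  have h2 := ((hasDerivAt_id τ).const_mul (-(2 * d * N / h))).exp
  refine HasDerivAt.congr_deriv (h2.smul h1) ?_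
  ext x
  simp [heatFlow]
  ring

/-- The negative diagonal part of `N h Δ^h` sits in the scalar factor of `heatFlow`; the operator
that is exponentiated has only nonnegative coefficients. -/
lemma heatFlow_nonneg {N h τ : ℝ} (hN : 0 ≤ N) (hh : 0 < h) (hτ : 0 ≤ τ) {f : E d →ᵇ ℝ}
    (hf : ∀ x, 0 ≤ f x) (x : E d) : 0 ≤ heatFlow N h f τ x := by
  refine mul_nonneg (Real.exp_pos _).le (opExp_apply_nonneg (fun g hg y => ?_) hf x)
  simp only [smul_apply, BoundedContinuousFunction.smul_apply, neighbourSum_apply, smul_eq_mul]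
  have : 0 ≤ ∑ i, (g (y + h • EuclideanSpace.single i (1 : ℝ)) +
      g (y - h • EuclideanSpace.single i (1 : ℝ))) :=
    Finset.sum_nonneg fun i _ => add_nonneg (hg _) (hg _)
  positivity

lemma heatFlow_of_eigen {N h μ : ℝ} {f : E d →ᵇ ℝ} (hf : neighbourSum h f = μ • f) (τ : ℝ) :
    heatFlow N h f τ = Real.exp (N / h * (μ - 2 * d) * τ) • f := by
  have : (τ • ((N / h) • neighbourSum h)) f = (τ * (N / h) * μ) • f := by
    simp only [smul_apply, hf, smul_smul]
  rw [heatFlow, opExp_apply_of_eigen this, smul_smul, ← Real.exp_add]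
  congr 2; ring

lemma heatFlow_sub (N h : ℝ) (f g : E d →ᵇ ℝ) (τ : ℝ) :
    heatFlow N h (f - g) τ = heatFlow N h f τ - heatFlow N h g τ := by
  simp [heatFlow, smul_sub]

lemma heatFlow_smul (N h c : ℝ) (f : E d →ᵇ ℝ) (τ : ℝ) :
    heatFlow N h (c • f) τ = c • heatFlow N h f τ := by
  simp [heatFlow, smul_comm c]

lemma continuous_coord (i : Fin d) : Continuous fun x : E d => x i := by fun_prop

/-- The plane wave `cos (x_i / r)`. -/
def cosWave (i : Fin d) (r : ℝ) : E d →ᵇ ℝ :=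
  BoundedContinuousFunction.ofNormedAddCommGroup (fun x => Real.cos (x i / r))
    (Real.continuous_cos.comp ((continuous_coord i).div_const r)) 1 fun x => by
      simpa using Real.abs_cos_le_one (x i / r)

@[simp]
lemma cosWave_apply (i : Fin d) (r : ℝ) (x : E d) : cosWave i r x = Real.cos (x i / r) := rfl

lemma neighbourSum_cosWave (i : Fin d) (h r : ℝ) :
    neighbourSum h (cosWave i r) = (2 * d - 2 + 2 * Real.cos (h / r)) • cosWave i r := by
  ext x
  rw [neighbourSum_apply]
  have h1 : ∀ j, cosWave i r (x + h • EuclideanSpace.single j (1 : ℝ)) +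
      cosWave i r (x - h • EuclideanSpace.single j (1 : ℝ)) =
      2 * Real.cos (x i / r) + if i = j then (2 * Real.cos (h / r) - 2) * Real.cos (x i / r) else 0 := by
    intro j
    by_cases hij : i = j
    · subst hij
      simp only [cosWave_apply, PiLp.add_apply, PiLp.sub_apply, PiLp.smul_apply,
        PiLp.single_apply, if_true, smul_eq_mul, mul_one, add_div, sub_div, Real.cos_add,
        Real.cos_sub]
      ring
    · simp [hij]; ring
  simp only [h1, Finset.sum_add_distrib, Finset.sum_ite_eq, Finset.mem_univ, if_true]
  simp
  ring

lemma neighbourSum_one (h : ℝ) :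
    neighbourSum h (1 : E d →ᵇ ℝ) = (2 * d : ℝ) • (1 : E d →ᵇ ℝ) := by
  ext x
  rw [neighbourSum_apply]
  simp; ring

/-- The truncated kink `min |x_i| 1`. -/
def kink (i : Fin d) : E d →ᵇ ℝ :=
  BoundedContinuousFunction.ofNormedAddCommGroup (fun x => min |x i| 1)
    (by fun_prop) 1 fun x => by
      rw [Real.norm_of_nonneg (le_min (abs_nonneg _) zero_le_one)]
      exact min_le_right _ _

@[simp]
lemma kink_apply (i : Fin d) (x : E d) : kink i x = min |x i| 1 := rfl

lemma one_sub_cos_le_abs (y : ℝ) : 1 - Real.cos y ≤ |y| := by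
  rcases le_total |y| 2 with h | h
  · have := Real.one_sub_sq_div_two_le_cos (x := y)
    nlinarith [abs_nonneg y, sq_abs y]
  · linarith [Real.neg_one_le_cos y]

lemma wave_le_kink (i : Fin d) {r : ℝ} (hr : 0 < r) (hr2 : r ≤ 1 / 2) (x : E d) :
    r * (1 - Real.cos (x i / r)) ≤ min |x i| 1 := by
  refine le_min ?_ ?_
  · have := mul_le_mul_of_nonneg_left (one_sub_cos_le_abs (x i / r)) hr.le
    rwa [abs_div, abs_of_pos hr, mul_div_cancel₀ _ hr.ne'] at this
  · nlinarith [Real.neg_one_le_cos (x i / r)]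

lemma le_heatFlow_kink (i : Fin d) {N h τ : ℝ} (hN : 1 ≤ N) (hh : 0 < h) (hh1 : h < 1) (hτ : 0 ≤ τ) :
    (1 - Real.exp (-τ)) / 2 * √h ≤ heatFlow N h (kink i) τ 0 := by
  have hs : 0 < √h := Real.sqrt_pos.2 hh
  have hs1 : √h ≤ 1 := Real.sqrt_le_one.2 hh1.le
  have hsq := Real.mul_self_sqrt hh.le
  -- At this scale the wave below the kink has height of order `√h` and decays at a rate at least
  -- `N`, independent of `h`.
  set r := √h / 2 with hr
  have hr0 : 0 < r := by positivity
  have h1 := heatFlow_nonneg (N := N) (f := kink i - r • (1 - cosWave i r)) (by linarith) hh hτ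
    (fun x => by
      have := wave_le_kink i hr0 (by linarith) x
      simpa using this) 0
  rw [heatFlow_sub, heatFlow_smul, heatFlow_sub, heatFlow_of_eigen (neighbourSum_one h),
    heatFlow_of_eigen (neighbourSum_cosWave i h r)] at h1
  simp only [sub_self, mul_zero, zero_mul, Real.exp_zero, one_smul,
    BoundedContinuousFunction.sub_apply, BoundedContinuousFunction.smul_apply, smul_eq_mul,
    BoundedContinuousFunction.coe_one, Pi.one_apply, cosWave_apply, PiLp.zero_apply, zero_div, Real.cos_zero,
    mul_one] at h1
  have hhr : h / r = 2 * √h := by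
    rw [div_eq_iff hr0.ne', hr]; linarith
  -- `cos (2 √h) = 1 - 2 sin² √h`, and Jordan's inequality with `π ≤ 4` gives `sin √h ≥ √h / 2`.
  have hcos : Real.cos (h / r) ≤ 1 - h / 2 := by
    have hpi4 := Real.pi_le_four
    have h1 := Real.mul_le_sin hs.le (by linarith [Real.pi_gt_three])
    have h2 : 1 / 2 * √h ≤ 2 / Real.pi * √h := by
      gcongr ?_ * _
      rw [div_le_div_iff₀ (by norm_num) Real.pi_pos]
      linarith
    rw [hhr, Real.cos_two_mul, Real.cos_sq']
    nlinarith
  have hexp : N / h * (2 * d - 2 + 2 * Real.cos (h / r) - 2 * d) * τ ≤ -τ := by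
    have h4 : N / h * (2 * d - 2 + 2 * Real.cos (h / r) - 2 * d) ≤ N / h * (-h) := by
      gcongr; linarith
    have h5 : N / h * (-h) = -N := by field_simp
    nlinarith
  have h6 := Real.exp_le_exp.2 hexp
  have h7 : r * (1 - Real.exp (-τ)) ≤
      r * (1 - Real.exp (N / h * (2 * d - 2 + 2 * Real.cos (h / r) - 2 * d) * τ)) := by gcongr
  have h8 : (1 - Real.exp (-τ)) / 2 * √h = r * (1 - Real.exp (-τ)) := by rw [hr]; ring
  linarith

/-- The problem without running cost and drift whose terminal cost is the truncated kink. -/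
def kinkProblem (i : Fin d) : ControlProblem d 0 where
  A := {0}
  c := fun _ _ _ => 0
  f := fun _ _ _ => 0
  q := kink i

lemma kinkProblem_H (i : Fin d) (t : ℝ) (x p : E d) : (kinkProblem i).H t x p = 0 := by
  simp [ControlProblem.H, ControlProblem.preHamiltonian, kinkProblem]

lemma kink_lipschitz (i : Fin d) : LipschitzWith 1 (kink i) := by
  have h : LipschitzWith 1 fun x : E d => |x i| := LipschitzWith.of_dist_le_mul fun x y => by
    rw [NNReal.coe_one, one_mul, Real.dist_eq, dist_eq_norm]
    exact (abs_abs_sub_abs_le_abs_sub _ _).trans (abs_apply_le_norm (x - y) i)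
  exact h.min_const 1

lemma kinkProblem_standing (i : Fin d) (T : ℝ) {N : ℝ} (hN : 1 ≤ N) :
    Standing (kinkProblem i) T 1 N where
  compact := isCompact_singleton
  a1 :=
    { c_bound := fun t _ x a _ => by simp [kinkProblem]
      f_bound := fun t _ x a _ => by simp [kinkProblem]
      q_bound := fun x => by
        change |kink i x| ≤ 1
        rw [kink_apply, abs_of_nonneg (le_min (abs_nonneg _) zero_le_one)]
        exact min_le_right _ _
      c_lip := (LipschitzWith.const' (0 : ℝ)).lipschitzOnWith
      f_lip := (LipschitzWith.const' (0 : E d)).lipschitzOnWith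
      q_lip := kink_lipschitz i }
  a2 := by
    refine ⟨fun _ _ _ => 0, fun t _ x p => ⟨rfl, fun a ha => ?_, fun b hb _ => hb⟩,
      (LipschitzWith.const' (0 : E 0)).lipschitzOnWith⟩
    rw [mem_singleton_iff.1 ha]
  one_le := hN
  f_le := fun t _ x a _ => by simp [kinkProblem]; linarith

/-- The solution is constant in time, so at a contact point the test function is stationary in `t`.
-/
lemma kinkProblem_viscosity (i : Fin d) (T : ℝ) :
    IsViscositySolution (kinkProblem i) T (fun _ => kink i) where
  bddCont := ⟨((kink i).continuous.comp continuous_snd).continuousOn, ‖kink i‖,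
    fun t _ x => (kink i).norm_coe_le_norm x⟩
  sub φ _ t _ x hmax := by
    have h : IsLocalMin (fun s => φ (s, x)) t := by
      have hc : Filter.Tendsto (fun s : ℝ => (s, x)) (nhds t) (nhds (t, x)) :=
        Continuous.tendsto (by fun_prop) t
      filter_upwards [hc.eventually hmax] with s hs
      linarith
    rw [h.deriv_eq_zero, kinkProblem_H, add_zero]
  super φ _ t _ x hmin := by
    have h : IsLocalMax (fun s => φ (s, x)) t := by
      have hc : Filter.Tendsto (fun s : ℝ => (s, x)) (nhds t) (nhds (t, x)) :=
        Continuous.tendsto (by fun_prop) t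
      filter_upwards [hc.eventually hmin] with s hs
      linarith
    rw [h.deriv_eq_zero, kinkProblem_H, add_zero]
  terminal x := rfl

lemma kinkProblem_scheme (i : Fin d) (T N : ℝ) {h : ℝ} (hh : 0 < h) :
    IsSchemeSolution (kinkProblem i) T N h (fun t => heatFlow N h (kink i) (T - t)) where
  bddCont := by
    have hc : Continuous fun t => heatFlow N h (kink i) (T - t) := by
      have : Continuous (heatFlow N h (kink i)) := continuous_iff_continuousAt.2 fun τ =>
        (hasDerivAt_heatFlow N h (kink i) τ).continuousAt
      fun_prop
    refine ⟨?_, ?_⟩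
    · have : Continuous fun z : ℝ × E d => heatFlow N h (kink i) (T - z.1) z.2 :=
        (continuous_eval (F := E d →ᵇ ℝ)).comp
          ((hc.comp continuous_fst).prodMk continuous_snd)
      exact this.continuousOn
    · obtain ⟨B, hB⟩ := isCompact_Icc.exists_bound_of_continuousOn (s := Icc 0 T) hc.continuousOn
      exact ⟨B, fun t ht x =>
        (BoundedContinuousFunction.norm_coe_le_norm _ x).trans (hB t ht)⟩
  eqn t _ x := by
    have h1 := (hasDerivAt_heatFlow N h (kink i) (T - t)).scomp t ((hasDerivAt_id t).const_sub T)
    have h2 := (BoundedContinuousFunction.evalCLM ℝ x).hasFDerivAt.comp_hasDerivAt t h1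
    refine ⟨_, h2, ?_⟩
    rw [kinkProblem_H, discLaplacian_eq_neighbourSum]
    simp
    field_simp
  terminal x := by simp [heatFlow_zero, kinkProblem]

end HJB

end

/-! ### Choice of constants and conclusion -/

theorem theorem2p5 (d : ℕ) (hd : 1 ≤ d) (N : ℝ) (hN : 1 ≤ N) :
    -- the error bounds, with `C` depending only on `d`, `N` and the constant in (A1)-(A2)
    (∀ K : ℝ≥0, ∃ C : ℝ, 0 < C ∧
      ∀ (m : ℕ) (P : HJB.ControlProblem d m) (T : ℝ), 0 < T → HJB.Standing P T K N →
      ∀ v : ℝ → HJB.E d → ℝ, HJB.IsViscositySolution P T v →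
        -- `v` is Lipschitz in space and `‖∇v‖_∞` is finite
        (∃ L : ℝ≥0, ∀ t ∈ Icc 0 T, LipschitzWith L (v t)) ∧
        HJB.gradSupNorm T v < ⊤ ∧
        ∀ h : ℝ, 0 < h → h < 1 →
        ∀ vh : ℝ → HJB.E d → ℝ, HJB.IsSchemeSolution P T N h vh →
          (∀ t ∈ Icc 0 T, ∀ x, |v t x - vh t x| ≤
            C * (1 + T) * (1 + (HJB.gradSupNorm T v).toReal) * √h) ∧
          (∀ t ∈ Icc 0 T, ∀ x, |v t x - vh t x| ≤ C * Real.exp (C * T) * √h)) ∧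
    -- sharpness of the rate
    (∀ T : ℝ, 0 < T → ∃ (m : ℕ) (P : HJB.ControlProblem d m) (K : ℝ≥0),
      HJB.Standing P T K N ∧
      ∃ v : ℝ → HJB.E d → ℝ, HJB.IsViscositySolution P T v ∧
      ∃ κ : ℝ, 0 < κ ∧ ∀ h : ℝ, 0 < h → h < 1 →
        ∃ vh : ℝ → HJB.E d → ℝ, HJB.IsSchemeSolution P T N h vh ∧
          ∃ t ∈ Icc 0 T, ∃ x, κ * √h ≤ |v t x - vh t x|) := by
  refine ⟨fun K => ?_, fun T hT => ?_⟩
  · have hK : (0 : ℝ) ≤ K := K.2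
    have hN0 : 0 ≤ N := by linarith
    obtain ⟨C₁, hC₁⟩ : ∃ C₁ : ℝ, C₁ = (K + 2) + 2 * K * (K + 3) + d * N * (K + 2) := ⟨_, rfl⟩
    have hdN : 0 ≤ d * N * (K + 2 : ℝ) := by positivity
    have hKK : 0 ≤ 2 * K * (K + 3 : ℝ) := by positivity
    have hC₁1 : 1 ≤ C₁ := by linarith
    -- the error bound in terms of a Lipschitz constant `G`
    have main : ∀ {m : ℕ} {P : HJB.ControlProblem d m} {T : ℝ}, 0 < T → HJB.Standing P T K N →
        ∀ {v : ℝ → HJB.E d → ℝ}, HJB.IsViscositySolution P T v → ∀ {G : ℝ}, 0 ≤ G →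
        (∀ t ∈ Icc 0 T, ∀ x y, v t x - v t y ≤ G * ‖x - y‖) →
        ∀ {h : ℝ}, 0 < h → ∀ {vh : ℝ → HJB.E d → ℝ}, HJB.IsSchemeSolution P T N h vh →
        ∀ t ∈ Icc 0 T, ∀ x, |v t x - vh t x| ≤ C₁ * (1 + T) * (1 + G) * √h := by
      intro m P T hT hP v hv G hG hL h hh vh hvh t ht x
      refine (hvh.error_le hT hP hv hh hG hL ht x).trans ?_
      gcongr
      have h1 : 2 * G + K + 1 ≤ (K + 2) * (1 + G) := by nlinarith
      have h2 : 2 * G + K + 2 ≤ (K + 3) * (1 + G) := by nlinarith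
      have h3 : 2 * K * (2 * G + K + 2) ≤ 2 * K * ((K + 3) * (1 + G)) := by gcongr
      have h4 : d * N * (2 * G + K + 1) ≤ d * N * ((K + 2) * (1 + G)) := by gcongr
      have h5 : (2 * K * (2 * G + K + 2) + d * N * (2 * G + K + 1)) * T ≤
          (2 * K * ((K + 3) * (1 + G)) + d * N * ((K + 2) * (1 + G))) * T := by gcongr
      have h6 : 0 ≤ ((K + 2 : ℝ) * T + 2 * K * (K + 3) + d * N * (K + 2)) * (1 + G) := by positivity
      rw [hC₁]
      linarith
    -- `C₁ * (K + 2)` is the prefactor of the second bound; `2 K + 1` covers the exponent `T + 2 K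
    -- T`, coming from `1 + T ≤ exp T` and the Lipschitz constant.
    obtain ⟨C, hC⟩ : ∃ C : ℝ, C = C₁ * (K + 2) + 2 * K + 1 := ⟨_, rfl⟩
    have hCC₁ : C₁ ≤ C := by nlinarith
    refine ⟨C, by linarith, fun m P T hT hP v hv => ?_⟩
    have hlip : ∀ t ∈ Icc 0 T, ∀ x y, v t x - v t y ≤ (K + 1) * Real.exp (2 * K * T) * ‖x - y‖ :=
      fun t ht x y => hv.sub_le hT hP ht x y
    have hL0 : 0 ≤ (K + 1) * Real.exp (2 * K * T) := by positivity
    have hL : ∀ t ∈ Icc 0 T, LipschitzWith (NNReal.mk ((K + 1) * Real.exp (2 * K * T)) hL0) (v t) :=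
      fun t ht => LipschitzWith.of_le_add_mul _ fun x y => by
        have := hlip t ht x y
        rw [dist_eq_norm, NNReal.coe_mk]
        linarith
    refine ⟨⟨_, hL⟩, (HJB.gradSupNorm_le hL).trans_lt ENNReal.coe_lt_top,
      fun h hh _ vh hvh => ⟨fun t ht x => ?_, fun t ht x => ?_⟩⟩
    · refine (main hT hP hv ENNReal.toReal_nonneg
        (fun t ht x y => HJB.sub_le_gradSupNorm hT hv.bddCont hL ht x y) hh hvh t ht x).trans ?_
      gcongr
    · refine (main hT hP hv hL0 hlip hh hvh t ht x).trans ?_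
      refine mul_le_mul_of_nonneg_right ?_ (Real.sqrt_nonneg h)
      have h1 : 1 + T ≤ Real.exp T := by linarith [Real.add_one_le_exp T]
      have h2 : 1 ≤ Real.exp (2 * K * T) := Real.one_le_exp (by positivity)
      have h3 : 1 + (K + 1) * Real.exp (2 * K * T) ≤ (K + 2) * Real.exp (2 * K * T) := by linarith
      have h4 : T + 2 * K * T ≤ C * T := by
        rw [← one_add_mul]
        gcongr
        nlinarith
      calc C₁ * (1 + T) * (1 + (K + 1) * Real.exp (2 * K * T))
          ≤ C₁ * Real.exp T * ((K + 2) * Real.exp (2 * K * T)) := by gcongr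
        _ = C₁ * (K + 2) * Real.exp (T + 2 * K * T) := by rw [Real.exp_add]; ring
        _ ≤ C * Real.exp (C * T) := by
          gcongr
          · linarith
          · linarith
  · let i : Fin d := ⟨0, hd⟩
    have hexp : Real.exp (-T) < 1 := by
      rw [← Real.exp_zero]
      exact Real.exp_lt_exp.2 (by linarith)
    -- The error is measured at time `0` and at the origin, where `v` vanishes and the discrete heat
    -- flow has run for the full time `T`.
    refine ⟨0, HJB.kinkProblem i, 1, HJB.kinkProblem_standing i T hN, fun _ => HJB.kink i,
      HJB.kinkProblem_viscosity i T, (1 - Real.exp (-T)) / 2, by linarith, fun h hh hh1 =>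
      ⟨_, HJB.kinkProblem_scheme i T N hh, 0, ⟨le_rfl, hT.le⟩, 0, ?_⟩⟩
    have h1 := HJB.le_heatFlow_kink i hN hh hh1 hT.le
    rw [abs_sub_comm, sub_zero]
    simpa using h1.trans (le_abs_self _)
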